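/- **Theorem (Safety of AlterBFT).** In the hybrid synchronous model with $n>2f$, no two honest replicas running AlterBFT (with or without the fast commit rule, i.e. FastAlterBFT or plain AlterBFT) ever commit different blocks at the same height. *Model.* There are $n$ replicas, at most $f$ of them faulty (Byzantine), $n>2f$; the others are honest. Time is real-valued; local clocks run at the same speed, and honest replicas act without delay. Let $\Delta_S,\Delta_L>0$. A message broadcast by an honest replica at time $t$ reaches every honest replica by $t+\Delta_S$ if it is small, and by $\max\{t,GST\}+\Delta_L$ if it is large; proposals are large, all other messages are small. Honest replicas start within $\Delta_S$ of each other. Faulty replicas may send anything at any time, except that signatures of honest replicas cannot be forged. A message that is due by the instant at which a timer expires is processed before the expiry. The hash function $id$ on blocks is injective. *Blocks.* A block $b$ has a payload and a field $prev$: the hash of its predecessor, or $nil$ for a first block. A first block has height $1$, and a block whose predecessor has height $k$ has height $k+1$. A block extends itself, its predecessor, and everything its predecessor extends. *Protocol.* Epochs are numbered $0,1,2,\dots$, and every epoch $e$ has a leader $\mathrm{leader}(e)$. A block certificate of epoch $e$ for the hash $h$ consists of votes $\langle \mathrm{VOTE},e,h\rangle$ signed by at least $f+1$ distinct replicas; a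 silence certificate of $e$ consists of messages $\langle \mathrm{SILENCE},e\rangle$ signed by at least $f+1$ distinct replicas; an equivocation certificate of $e$ consists of two votes signed by $\mathrm{leader}(e)$ in epoch $e$ for different hashes. A replica obtains a certificate either from the individual messages or from a message $\langle\mathrm{QUIT\text{-}EPOCH},cert\rangle$. An honest replica $p$ keeps its current epoch $e_p$, a flag telling whether it has voted in $e_p$, a block certificate $lockedBC$ (initially $nil$), for each started epoch a state (active, committed or not-committed), and for each epoch a decision. It applies the following rules to all messages received so far, as soon as they apply. 1. *Starting epoch $e$* (at the beginning $e=0$): set $e_p=e$, not voted, epoch $e$ active, and start a timer $timeoutCertificate(e)$ of length $\Delta_L+4\Delta_S$. If $p=\mathrm{leader}(e)$: propose at once if $e=0$ or $lockedBC$ is of epoch $e-1$; otherwise propose after $2\Delta_S$, if still in epoch $e$. To propose, $p$ broadcasts $\langle\mathrm{PROPOSE},e,b,lockedBC\rangle$, where $b$ has an arbitrary payload and $b.prev$ is the hash certified by $lockedBC$ ($nil$ if $lockedBC=nil$), and its signed vote for $id(b)$; it then counts as having voted. 2. *Voting.* If $p$ has $\langle\mathrm{PROPOSE},e_p,b,BC\rangle$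 and the vote of $\mathrm{leader}(e_p)$ for $id(b)$ in $e_p$, epoch $e_p$ is active, $p$ has not voted in $e_p$, $b$ satisfies a fixed validity predicate, $BC$ is $nil$ or a block certificate, $b.prev$ is the hash certified by $BC$ ($nil$ if $BC=nil$), and either $lockedBC=nil$ or $BC\ne nil$ is of an epoch at least that of $lockedBC$, then $p$ broadcasts its signed vote for $id(b)$ and forwards the leader's vote and the proposal to all. 3. *Block certificate $c$ of epoch $e_p$ for $h$*: set $lockedBC=c$; if $e_p$ is active, start a timer $timeoutCommit(e_p,h)$ of length $2\Delta_S$; broadcast $\langle\mathrm{QUIT\text{-}EPOCH},c\rangle$; start epoch $e_p+1$. *Block certificate $c$ of another epoch*: if $p=\mathrm{leader}(e_p)$ and $lockedBC$ is $nil$ or of a smaller epoch than $c$, set $lockedBC=c$ and broadcast $\langle\mathrm{QUIT\text{-}EPOCH},c\rangle$. 4. *Silence or equivocation certificate of an active epoch $e$*: epoch $e$ becomes not-committed; if $e=e_p$, broadcast the certificate in a $\mathrm{QUIT\text{-}EPOCH}$ message and start a timer $timeoutCommit(e,nil)$ of length $2\Delta_S$; when that expires and still $e_p=e$, start epoch $e+1$.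 5. *Expiry of $timeoutCertificate(e)$*: if $e=e_p$ and $e$ is active, broadcast a signed $\langle\mathrm{SILENCE},e\rangle$. 6. *Regular commit rule.* When $timeoutCommit(e,h)$ with $h\ne nil$ expires and $e$ is active, $e$ becomes committed with decision $h$. 7. *Fast commit rule (only in FastAlterBFT).* When $p$ has votes of all $n$ replicas for the same hash $h$ in an epoch $e$ that is active, $e$ becomes committed with decision $h$. 8. When $p$ has $\langle\mathrm{PROPOSE},e,b,\cdot\rangle$ and the decision of $e$ is $id(b)$, it commits $b$ and all blocks that $b$ extends. The theorem holds also if a block counts as committed by $p$ as soon as it, or a block extending it, has its hash as the decision of some epoch at $p$, even if the decided block has not arrived yet. That is: if honest replicas $p$ and $q$ have committed blocks $b$ and $b'$ of the same height in an execution, then $b=b'$. -/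

import Mathlib

namespace AlterBFT

/-- A block carries a payload and the hash of its predecessor (`none` for a first block). -/
@[ext]
structure Block (P H : Type*) where
  payload : P
  prev : Option H

/-- `Parent hash a b`: the block `b` names `a` as its predecessor. -/
def Parent {P H : Type*} (hash : Block P H → H) (a b : Block P H) : Prop :=
  b.prev = some (hash a)

/-- `Ancestor hash a b`: `b` extends `a`, i.e. `a` is reached from `b` by following
predecessor links (every block extends itself). -/
def Ancestor {P H : Type*} (hash : Block P H → H) : Block P H → Block P H → Prop :=
  Relation.ReflTransGen (Parent hash)

/-- `HasHeight hash b k`: the chain ending in `b` has exactly `k` blocks. -/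
inductive HasHeight {P H : Type*} (hash : Block P H → H) : Block P H → ℕ → Prop
  | first (b : Block P H) (hb : b.prev = none) : HasHeight hash b 1
  | next (a b : Block P H) (k : ℕ) (hab : Parent hash a b) (ha : HasHeight hash a k) :
      HasHeight hash b (k + 1)

/-- The contents that replicas sign. -/
inductive Content (H : Type*)
  | vote (e : ℕ) (h : H)
  | silence (e : ℕ)

/-- A block certificate: votes of the replicas in `signers`, in `epoch`, for the hash `id`. -/
structure BlockCert (n : ℕ) (H : Type*) where
  epoch : ℕ
  id : H
  signers : Finset (Fin n)

inductive Cert (n : ℕ) (H : Type*)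
  /-- votes of distinct replicas for one hash in one epoch -/
  | block (c : BlockCert n H)
  /-- silence messages of distinct replicas for one epoch -/
  | silence (e : ℕ) (signers : Finset (Fin n))
  /-- two votes signed by `l` in epoch `e` -/
  | equiv (l : Fin n) (e : ℕ) (h h' : H)

def Cert.epoch {n : ℕ} {H : Type*} : Cert n H → ℕ
  | .block c => c.epoch
  | .silence e _ => e
  | .equiv _ e _ _ => e

/-- The pairs (signer, signed content) that a block certificate is made of. -/
def BlockCert.sigs {n : ℕ} {H : Type*} (c : BlockCert n H) : Set (Fin n × Content H) :=
  {x | x.1 ∈ c.signers ∧ x.2 = .vote c.epoch c.id}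

/-- The pairs (signer, signed content) that a certificate is made of. -/
def Cert.sigs {n : ℕ} {H : Type*} : Cert n H → Set (Fin n × Content H)
  | .block c => c.sigs
  | .silence e signers => {x | x.1 ∈ signers ∧ x.2 = .silence e}
  | .equiv l e h h' => {(l, .vote e h), (l, .vote e h')}

inductive Msg (n : ℕ) (P H : Type*)
  /-- `⟨PROPOSE, e, b, bc⟩`, not signed -/
  | propose (e : ℕ) (b : Block P H) (bc : Option (BlockCert n H))
  /-- `⟨VOTE, e, h⟩` or `⟨SILENCE, e⟩`, signed by `p` -/
  | signed (p : Fin n) (c : Content H)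
  /-- `⟨QUIT-EPOCH, cert⟩` -/
  | quit (c : Cert n H)

/-- All signatures that occur in a message. -/
def Msg.sigs {n : ℕ} {P H : Type*} : Msg n P H → Set (Fin n × Content H)
  | .propose _ _ bc => {x | ∃ c ∈ bc, x ∈ c.sigs}
  | .signed p c => {(p, c)}
  | .quit c => c.sigs

/-- State of an epoch at a replica (an epoch that was never started has none). -/
inductive Status
  | active
  | committed
  | notCommitted

inductive Timer (H : Type*)
  | epochChange (e : ℕ)
  | certificate (e : ℕ)
  | commit (e : ℕ) (id : Option H)

/-- The data of a system that runs the protocol. -/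
structure System (n : ℕ) (P H : Type*) where
  /-- bound on the number of faulty replicas -/
  f : ℕ
  /-- the replicas that are actually faulty -/
  faulty : Finset (Fin n)
  leader : ℕ → Fin n
  /-- the hash of a block -/
  hash : Block P H → H
  /-- the application's validity predicate -/
  valid : Block P H → Prop
  /-- delay bound for small messages -/
  ΔS : ℝ
  /-- delay bound for large messages after stabilization -/
  ΔL : ℝ
  /-- global stabilization time -/
  GST : ℝ
  /-- the time at which an honest replica begins the execution -/
  start : Fin n → ℝ
  /-- whether the fast commit rule is part of the protocol (`FastAlterBFT`) or not -/
  fast : Prop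

/-- The local state of a replica; `log` holds the messages received so far, `timers` the running
timers with their expiry times, `ledger` the blocks handed over by `CommitBlock`. -/
structure Local (n : ℕ) (P H : Type*) where
  booted : Prop
  epoch : ℕ
  hasVoted : Prop
  locked : Option (BlockCert n H)
  status : ℕ → Option Status
  decision : ℕ → Option H
  log : Set (Msg n P H)
  timers : Set (Timer H × ℝ)
  ledger : Set (Block P H)

def Local.initial (n : ℕ) (P H : Type*) : Local n P H where
  booted := False
  epoch := 0
  hasVoted := False
  locked := none
  status := fun _ => none
  decision := fun _ => none
  log := ∅
  timers := ∅
  ledger := ∅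

namespace System

variable {n : ℕ} {P H : Type*}

def Honest (S : System n P H) (p : Fin n) : Prop := p ∉ S.faulty

/-- The time by which a message that an honest replica broadcasts at time `t` reaches every honest
replica. Proposals carry blocks and are large; all other messages are small. -/
def deadline (S : System n P H) : Msg n P H → ℝ → ℝ
  | .propose _ _ _, t => max t S.GST + S.ΔL
  | .signed _ _, t => t + S.ΔS
  | .quit _, t => t + S.ΔS

def ValidBlockCert (S : System n P H) (c : BlockCert n H) : Prop := S.f + 1 ≤ c.signers.card

/-- The replica has a block certificate, from a `QUIT-EPOCH` message or from single votes. -/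
def HasBlockCert (S : System n P H) (log : Set (Msg n P H)) (c : BlockCert n H) : Prop :=
  S.ValidBlockCert c ∧
    (.quit (.block c) ∈ log ∨ ∀ q ∈ c.signers, .signed q (.vote c.epoch c.id) ∈ log)

/-- Well-formed silence and equivocation certificates. -/
def ValidMisbehavior (S : System n P H) : Cert n H → Prop
  | .block _ => False
  | .silence _ signers => S.f + 1 ≤ signers.card
  | .equiv l e h h' => l = S.leader e ∧ h ≠ h'

/-- The replica has a silence or equivocation certificate, from a `QUIT-EPOCH` message or from
the single messages that it consists of. -/
def HasMisbehavior (S : System n P H) (log : Set (Msg n P H)) (c : Cert n H) : Prop :=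
  S.ValidMisbehavior c ∧ (.quit c ∈ log ∨ ∀ x ∈ c.sigs, .signed x.1 x.2 ∈ log)

/-- The block that a leader in state `s` proposes with payload `pl`. -/
def newBlock (s : Local n P H) (pl : P) : Block P H where
  payload := pl
  prev := s.locked.map BlockCert.id

/-- The messages that `Propose()` broadcasts. -/
def proposal (S : System n P H) (p : Fin n) (s : Local n P H) (pl : P) : List (Msg n P H) :=
  [.propose s.epoch (newBlock s pl) s.locked,
    .signed p (.vote s.epoch (S.hash (newBlock s pl)))]

/-- The assignments at the beginning of `StartEpoch(e)`, and the start of `timeoutCertificate`. -/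
def enter (S : System n P H) (now : ℝ) (e : ℕ) (s : Local n P H) : Local n P H :=
  { s with
    epoch := e
    hasVoted := False
    status := Function.update s.status e (some .active)
    decision := Function.update s.decision e none
    timers := insert (.certificate e, now + (S.ΔL + 4 * S.ΔS)) s.timers }

/-- The leader of epoch `e` need not wait before it proposes. -/
def ProposesAtOnce (s : Local n P H) (e : ℕ) : Prop :=
  e = 0 ∨ ∃ c, s.locked = some c ∧ c.epoch + 1 = e

/-- `S.StartEpoch p now e s s' out`: executing `StartEpoch(e)` at time `now` may lead replica `p`
from `s` to `s'` and broadcasts `out`. -/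
inductive StartEpoch (S : System n P H) (p : Fin n) (now : ℝ) (e : ℕ) (s : Local n P H) :
    Local n P H → List (Msg n P H) → Prop
  | follower (hp : S.leader e ≠ p) : StartEpoch S p now e s (S.enter now e s) []
  | propose (hp : S.leader e = p) (hs : ProposesAtOnce s e) (pl : P) :
      StartEpoch S p now e s { S.enter now e s with hasVoted := True }
        (S.proposal p (S.enter now e s) pl)
  | wait (hp : S.leader e = p) (hs : ¬ ProposesAtOnce s e) :
      StartEpoch S p now e s
        { S.enter now e s with
          timers := insert (.epochChange e, now + 2 * S.ΔS) (S.enter now e s).timers } []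

/-- A proposal with block `b` and certificate `bc` is acceptable: the block is valid, its
predecessor is the block certified by `bc`, and `bc` is at least as recent as the lock. -/
def Accepts (S : System n P H) (s : Local n P H) (b : Block P H)
    (bc : Option (BlockCert n H)) : Prop :=
  S.valid b ∧ (∀ c ∈ bc, S.ValidBlockCert c) ∧ b.prev = bc.map BlockCert.id ∧
    (s.locked = none ∨ ∃ l c, s.locked = some l ∧ bc = some c ∧ l.epoch ≤ c.epoch)

/-- The rules of an honest replica that are triggered by received messages:
`S.MsgStep p now s s' out` leads from `s` to `s'` and broadcasts `out`. Rules are evaluated on the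
whole log, so a message that arrives early is used as soon as its rule applies. -/
inductive MsgStep (S : System n P H) (p : Fin n) (now : ℝ) (s : Local n P H) :
    Local n P H → List (Msg n P H) → Prop
  /-- vote for the proposal; forward the leader's vote and the proposal -/
  | vote (b : Block P H) (bc : Option (BlockCert n H))
      (hprop : .propose s.epoch b bc ∈ s.log)
      (hlead : .signed (S.leader s.epoch) (.vote s.epoch (S.hash b)) ∈ s.log)
      (hact : s.status s.epoch = some .active) (hvote : ¬ s.hasVoted) (hacc : S.Accepts s b bc) :
      MsgStep S p now s { s with hasVoted := True }
        [.signed p (.vote s.epoch (S.hash b)),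
          .signed (S.leader s.epoch) (.vote s.epoch (S.hash b)),
          .propose s.epoch b bc]
  /-- block certificate of the current epoch, received while the epoch is active -/
  | blockCertActive (c : BlockCert n H) (hc : S.HasBlockCert s.log c) (he : c.epoch = s.epoch)
      (hact : s.status s.epoch = some .active) (s' : Local n P H) (out : List (Msg n P H))
      (hstart : S.StartEpoch p now (s.epoch + 1)
        { s with
          locked := some c
          timers := insert (.commit s.epoch (some c.id), now + 2 * S.ΔS) s.timers } s' out) :
      MsgStep S p now s s' (.quit (.block c) :: out)
  /-- block certificate of the current epoch, received when the epoch is no longer active -/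
  | blockCertInactive (c : BlockCert n H) (hc : S.HasBlockCert s.log c) (he : c.epoch = s.epoch)
      (hact : s.status s.epoch ≠ some .active) (s' : Local n P H) (out : List (Msg n P H))
      (hstart : S.StartEpoch p now (s.epoch + 1) { s with locked := some c } s' out) :
      MsgStep S p now s s' (.quit (.block c) :: out)
  /-- the leader learns a more recent block certificate of another epoch -/
  | blockCertLeader (c : BlockCert n H) (hc : S.HasBlockCert s.log c) (he : c.epoch ≠ s.epoch)
      (hp : S.leader s.epoch = p) (hl : ∀ l, s.locked = some l → l.epoch < c.epoch) :
      MsgStep S p now s { s with locked := some c } [.quit (.block c)]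
  /-- fast commit rule: votes from all replicas -/
  | fastCommit (hfast : S.fast) (e : ℕ) (h : H) (hall : ∀ q, .signed q (.vote e h) ∈ s.log)
      (hact : s.status e = some .active) :
      MsgStep S p now s
        { s with
          status := Function.update s.status e (some .committed)
          decision := Function.update s.decision e (some h) } []
  /-- silence or equivocation certificate of the current epoch -/
  | misbehaviorCurrent (c : Cert n H) (hc : S.HasMisbehavior s.log c) (he : c.epoch = s.epoch)
      (hact : s.status c.epoch = some .active) :
      MsgStep S p now s
        { s with
          status := Function.update s.status c.epoch (some .notCommitted)
          timers := insert (.commit s.epoch none, now + 2 * S.ΔS) s.timers }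
        [.quit c]
  /-- silence or equivocation certificate of another epoch that is still active -/
  | misbehaviorOther (c : Cert n H) (hc : S.HasMisbehavior s.log c) (he : c.epoch ≠ s.epoch)
      (hact : s.status c.epoch = some .active) :
      MsgStep S p now s
        { s with status := Function.update s.status c.epoch (some .notCommitted) } []
  /-- `CommitBlock(b)`: a decided block has arrived; commit it and all its ancestors -/
  | commitBlock (e : ℕ) (b : Block P H) (bc : Option (BlockCert n H))
      (hprop : .propose e b bc ∈ s.log) (hdec : s.decision e = some (S.hash b))
      (hnew : b ∉ s.ledger) :
      MsgStep S p now s { s with ledger := s.ledger ∪ {a | Ancestor S.hash a b} } []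

/-- The effect of the expiry of a timer (which has already been removed from `s`). -/
inductive TimerStep (S : System n P H) (p : Fin n) (now : ℝ) (s : Local n P H) :
    Timer H → Local n P H → List (Msg n P H) → Prop
  /-- the leader proposes, if it is still in the epoch -/
  | propose (e : ℕ) (he : s.epoch = e) (pl : P) :
      TimerStep S p now s (.epochChange e) { s with hasVoted := True } (S.proposal p s pl)
  | proposeStale (e : ℕ) (he : s.epoch ≠ e) : TimerStep S p now s (.epochChange e) s []
  | silence (e : ℕ) (he : s.epoch = e ∧ s.status e = some .active) :
      TimerStep S p now s (.certificate e) s [.signed p (.silence e)]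
  | silenceStale (e : ℕ) (he : ¬ (s.epoch = e ∧ s.status e = some .active)) :
      TimerStep S p now s (.certificate e) s []
  /-- regular commit rule -/
  | commit (e : ℕ) (h : H) (hact : s.status e = some .active) :
      TimerStep S p now s (.commit e (some h))
        { s with
          status := Function.update s.status e (some .committed)
          decision := Function.update s.decision e (some h) } []
  | commitNot (e : ℕ) (h : H) (hact : s.status e ≠ some .active) :
      TimerStep S p now s (.commit e (some h)) s []
  | nextEpoch (e : ℕ) (he : s.epoch = e) (s' : Local n P H) (out : List (Msg n P H))
      (hstart : S.StartEpoch p now (e + 1) s s' out) :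
      TimerStep S p now s (.commit e none) s' out
  | nextEpochStale (e : ℕ) (he : s.epoch ≠ e) : TimerStep S p now s (.commit e none) s []

/-- No rule triggered by received messages applies. -/
def Quiet (S : System n P H) (p : Fin n) (now : ℝ) (s : Local n P H) : Prop :=
  ∀ s' out, ¬ S.MsgStep p now s s' out

end System

/-- A global configuration: the current time, the local states (only those of honest replicas
matter), and the broadcasts `(sender, message, time)` made by honest replicas so far. -/
structure Config (n : ℕ) (P H : Type*) where
  now : ℝ
  loc : Fin n → Local n P H
  sent : Set (Fin n × Msg n P H × ℝ)

namespace System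

variable {n : ℕ} {P H : Type*}

def initial (n : ℕ) (P H : Type*) : Config n P H where
  now := 0
  loc := fun _ => Local.initial n P H
  sent := ∅

/-- Signatures of honest replicas cannot be forged: every signature of an honest replica in `m`
belongs to a message that this replica has broadcast before. Faulty replicas can produce any such
message `m`, and every message broadcast by an honest replica is of this kind. -/
def Genuine (S : System n P H) (C : Config n P H) (m : Msg n P H) : Prop :=
  ∀ x ∈ m.sigs, S.Honest x.1 → ∃ t, (x.1, .signed x.1 x.2, t) ∈ C.sent

/-- Replica `p` moves to state `s` and broadcasts `out`. -/
def update (C : Config n P H) (p : Fin n) (s : Local n P H) (out : List (Msg n P H)) :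
    Config n P H :=
  { C with
    loc := Function.update C.loc p s
    sent := C.sent ∪ {x | x.1 = p ∧ x.2.1 ∈ out ∧ x.2.2 = C.now} }

/-- The steps of the system in the hybrid synchronous model. -/
inductive Step (S : System n P H) (C : Config n P H) : Config n P H → Prop
  /-- an honest replica begins the execution with epoch 0 -/
  | boot (p : Fin n) (hp : S.Honest p) (hb : ¬ (C.loc p).booted) (ht : C.now = S.start p)
      (s' : Local n P H) (out : List (Msg n P H))
      (hs : S.StartEpoch p C.now 0 { C.loc p with booted := True } s' out) :
      Step S C (update C p s' out)
  /-- an honest replica receives a message, from an honest or a faulty replica -/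
  | receive (p : Fin n) (hp : S.Honest p) (m : Msg n P H) (hm : S.Genuine C m) :
      Step S C (update C p { C.loc p with log := insert m (C.loc p).log } [])
  /-- an honest replica executes a rule triggered by received messages -/
  | act (p : Fin n) (hp : S.Honest p) (hb : (C.loc p).booted)
      (s' : Local n P H) (out : List (Msg n P H)) (hs : S.MsgStep p C.now (C.loc p) s' out) :
      Step S C (update C p s' out)
  /-- a timer of an honest replica expires; messages that are due by this instant have been
  received, and have been processed, before -/
  | expire (p : Fin n) (hp : S.Honest p) (τ : Timer H) (hτ : (τ, C.now) ∈ (C.loc p).timers)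
      (hdue : ∀ q m t, (q, m, t) ∈ C.sent → S.deadline m t ≤ C.now → m ∈ (C.loc p).log)
      (hquiet : S.Quiet p C.now (C.loc p))
      (s' : Local n P H) (out : List (Msg n P H))
      (hs : S.TimerStep p C.now
        { C.loc p with timers := (C.loc p).timers \ {(τ, C.now)} } τ s' out) :
      Step S C (update C p s' out)
  /-- time passes; honest replicas act without delay, begin on time, serve their timers on time,
  and messages between honest replicas respect their deadlines -/
  | tick (t' : ℝ) (ht : C.now < t')
      (hstart : ∀ p, S.Honest p → ¬ (C.loc p).booted → t' ≤ S.start p)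
      (hquiet : ∀ p, S.Honest p → (C.loc p).booted → S.Quiet p C.now (C.loc p))
      (htimer : ∀ p, S.Honest p → ∀ τ d, (τ, d) ∈ (C.loc p).timers → t' ≤ d)
      (hdeliver : ∀ p, S.Honest p → ∀ q m t, (q, m, t) ∈ C.sent →
        m ∈ (C.loc p).log ∨ t' ≤ S.deadline m t) :
      Step S C { C with now := t' }

/-- The configurations that occur in executions of the system. -/
def Reachable (S : System n P H) : Config n P H → Prop :=
  Relation.ReflTransGen S.Step (initial n P H)

/-- Replica `p` has committed `b`: it has handed over `b` by `CommitBlock`, or it has decided, by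
one of the commit rules, the hash of `b` or of a block that extends `b` (the decided block itself
may still be missing). -/
def HasCommitted (S : System n P H) (C : Config n P H) (p : Fin n) (b : Block P H) : Prop :=
  b ∈ (C.loc p).ledger ∨
    ∃ e d, (C.loc p).decision e = some (S.hash d) ∧ Ancestor S.hash b d

end System

end AlterBFT

/-! A decision for `h` in epoch `e` forces all honest votes of epoch `e` to be for `h`
(`Decided.eq_of_voted`) and all honest votes of later epochs to be for blocks extending the one with
hash `h` (`Reachable.extends_of_voted`). Every decided hash has an honest vote, so of any two
decided blocks one extends the other. Since the hash is injective, the ancestors of one block form a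
chain, and this chain has at most one block of each height.

The timing argument is `Reachable.synchronized`: once there is evidence, dated `t`, that an epoch
has been started, every honest replica has reached it after `t + ΔS`; likewise, a silence or
equivocation certificate broadcast at `t` makes every honest replica give up its epoch after `t +
ΔS`.

Votes of the decided epoch agree. Under the fast rule every honest replica voted for `h`, and each
votes only once. Under the regular rule a block certificate was broadcast at some `t`. A different
vote by `t + ΔS` would, through the forwarded votes of the leader, give the decider an equivocation
certificate before its timer of length `2ΔS` expires; and nobody votes in `e` after `t + ΔS`,
because all have left.

Later votes build on the decided block. A replica can leave `e` without a block certificate only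
`2ΔS` after it broadcast a misbehavior certificate, say at `u`. If by `u + ΔS` a block certificate
was broadcast, or all honest replicas voted alike, then a block certificate reaches it by `u + 2ΔS`,
and it leaves with a lock instead. `Decided.not_skipped` shows that a decision always puts one of
these two events early enough. So whoever has left `e` is locked at an epoch at least `e`, and
proposes or accepts only blocks whose parent is certified in such an epoch. Each certificate
contains an earlier honest vote, and induction over the execution applies. -/

namespace AlterBFT

namespace System

variable {n : ℕ} {P H : Type*} {S : System n P H} {C C' : Config n P H}

/-! ### Broadcast events and the two kinds of steps -/

/-- Replica `q` broadcast its vote for `h` in epoch `e` at time `t`. -/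
def Voted (C : Config n P H) (q : Fin n) (e : ℕ) (h : H) (t : ℝ) : Prop :=
  (q, .signed q (.vote e h), t) ∈ C.sent

/-- Replica `q` broadcast the block certificate `c` at time `t`. -/
def QuitBlock (C : Config n P H) (q : Fin n) (c : BlockCert n H) (t : ℝ) : Prop :=
  (q, .quit (.block c), t) ∈ C.sent

/-- Replica `q` broadcast a silence or equivocation certificate of epoch `e` at time `t`. -/
def QuitMis (S : System n P H) (C : Config n P H) (q : Fin n) (e : ℕ) (t : ℝ) : Prop :=
  ∃ c, S.ValidMisbehavior c ∧ c.epoch = e ∧ (q, .quit c, t) ∈ C.sent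

/-- The log contains the votes of all replicas for `h` in epoch `e`. -/
def AllVotes (log : Set (Msg n P H)) (e : ℕ) (h : H) : Prop :=
  ∀ r, .signed r (.vote e h) ∈ log

/-- All messages due at `p` have arrived, and `p` has nothing left to process. -/
def Settled (S : System n P H) (C : Config n P H) (p : Fin n) : Prop :=
  (∀ q m t, (q, m, t) ∈ C.sent → S.deadline m t ≤ C.now → m ∈ (C.loc p).log) ∧
    S.Quiet p C.now (C.loc p)

theorem AllVotes.mono {log log' : Set (Msg n P H)} {e : ℕ} {h : H} (ha : AllVotes log e h)
    (hl : log ⊆ log') : AllVotes log' e h :=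
  fun r => hl (ha r)

/-- A step of a single honest replica. -/
inductive Act (S : System n P H) (C : Config n P H) (p : Fin n) :
    Local n P H → List (Msg n P H) → Prop
  | boot (hb : ¬ (C.loc p).booted) (ht : C.now = S.start p)
      (s' : Local n P H) (out : List (Msg n P H))
      (hs : S.StartEpoch p C.now 0 { C.loc p with booted := True } s' out) : Act S C p s' out
  | receive (m : Msg n P H) (hm : S.Genuine C m) :
      Act S C p { C.loc p with log := insert m (C.loc p).log } []
  | act (hb : (C.loc p).booted) (s' : Local n P H) (out : List (Msg n P H))
      (hs : S.MsgStep p C.now (C.loc p) s' out) : Act S C p s' out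
  | expire (τ : Timer H) (hτ : (τ, C.now) ∈ (C.loc p).timers) (hset : Settled S C p)
      (next : Local n P H) (out : List (Msg n P H))
      (hs : S.TimerStep p C.now
        { C.loc p with timers := (C.loc p).timers \ {(τ, C.now)} } τ next out) : Act S C p next out

/-- A step in which time passes until `t'`. -/
structure Tick (S : System n P H) (C : Config n P H) (t' : ℝ) : Prop where
  lt : C.now < t'
  start : ∀ p, S.Honest p → ¬ (C.loc p).booted → t' ≤ S.start p
  settled : ∀ p, S.Honest p → (C.loc p).booted → Settled S C p
  timer : ∀ p, S.Honest p → ∀ τ d, (τ, d) ∈ (C.loc p).timers → t' ≤ d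
  deliver : ∀ p, S.Honest p → ∀ q m t, (q, m, t) ∈ C.sent →
    m ∈ (C.loc p).log ∨ t' ≤ S.deadline m t

/-- Time cannot pass the deadline of an undelivered message, so a `tick` finds every booted honest
replica `Settled`. Thus the same completeness of information is available when time passes and when
a timer expires. -/
theorem Step.cases (h : S.Step C C') :
    (∃ p s' out, S.Honest p ∧ Act S C p s' out ∧ C' = update C p s' out) ∨
      ∃ t', Tick S C t' ∧ C' = { C with now := t' } := by
  cases h with
  | boot p hp hb ht s' out hs => exact .inl ⟨p, s', out, hp, .boot hb ht s' out hs, rfl⟩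
  | receive p hp m hm => exact .inl ⟨p, _, _, hp, .receive m hm, rfl⟩
  | act p hp hb s' out hs => exact .inl ⟨p, s', out, hp, .act hb s' out hs, rfl⟩
  | expire p hp τ hτ hdue hquiet s' out hs =>
    exact .inl ⟨p, s', out, hp, .expire τ hτ ⟨hdue, hquiet⟩ s' out hs, rfl⟩
  | tick t' ht hstart hquiet htimer hdeliver =>
    refine .inr ⟨t', ⟨ht, hstart, fun p hp hb => ⟨fun q m t hm hd => ?_, hquiet p hp hb⟩, htimer,
      hdeliver⟩, rfl⟩
    exact (hdeliver p hp q m t hm).resolve_right (by linarith)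

theorem Reachable.rec_on {Q : Config n P H → Prop} (init : Q (initial n P H))
    (act : ∀ C p s' out, S.Reachable C → Q C → S.Honest p → Act S C p s' out →
      Q (update C p s' out))
    (tick : ∀ C t', S.Reachable C → Q C → Tick S C t' → Q { C with now := t' })
    (hC : S.Reachable C) : Q C := by
  induction hC with
  | refl => exact init
  | tail hC hs ih =>
    rcases hs.cases with ⟨p, s', out, hp, ha, rfl⟩ | ⟨t', ht, rfl⟩
    · exact act _ p s' out hC ih hp ha
    · exact tick _ t' hC ih ht

theorem Reachable.after_act {p : Fin n} {s' : Local n P H} {out : List (Msg n P H)}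
    (hC : S.Reachable C) (hp : S.Honest p) (h : Act S C p s' out) :
    S.Reachable (update C p s' out) := by
  refine hC.tail ?_
  cases h with
  | boot hb ht _ _ hs => exact .boot p hp hb ht _ _ hs
  | receive m hm => exact .receive p hp m hm
  | act hb _ _ hs => exact .act p hp hb _ _ hs
  | expire τ hτ hset _ _ hs => exact .expire p hp τ hτ hset.1 hset.2 _ _ hs

theorem Reachable.after_tick {t' : ℝ} (hC : S.Reachable C) (h : Tick S C t') :
    S.Reachable { C with now := t' } :=
  hC.tail (.tick t' h.lt h.start (fun p hp hb => (h.settled p hp hb).2) h.timer h.deliver)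

theorem update_loc (p q : Fin n) (s : Local n P H) (out : List (Msg n P H)) :
    (update C p s out).loc q = if q = p then s else C.loc q := by
  simp [System.update, Function.update_apply]

theorem mem_update_sent {p q : Fin n} {s : Local n P H} {out : List (Msg n P H)}
    {m : Msg n P H} {t : ℝ} :
    (q, m, t) ∈ (update C p s out).sent ↔ (q, m, t) ∈ C.sent ∨ q = p ∧ m ∈ out ∧ t = C.now := by
  simp [System.update]

theorem update_now (p : Fin n) (s : Local n P H) (out : List (Msg n P H)) :
    (update C p s out).now = C.now := rfl

/-! ### Starting an epoch -/

section StartEpoch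

variable {p : Fin n} {now : ℝ} {e : ℕ} {s s' : Local n P H} {out : List (Msg n P H)}

theorem StartEpoch.spec (h : S.StartEpoch p now e s s' out) :
    s'.epoch = e ∧ s'.booted = s.booted ∧ s'.locked = s.locked ∧
    (∀ e', s'.status e' = if e' = e then some .active else s.status e') ∧
    (∀ e', s'.decision e' = if e' = e then none else s.decision e') ∧
    s'.log = s.log ∧ s'.ledger = s.ledger ∧
    s.timers ⊆ s'.timers ∧
    (∀ e' i d, (.commit e' i, d) ∈ s'.timers → (.commit e' i, d) ∈ s.timers) ∧
    (∀ e' d, (.epochChange e', d) ∈ s'.timers → (.epochChange e', d) ∈ s.timers ∨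
      e' = e ∧ d = now + 2 * S.ΔS ∧ S.leader e = p ∧ ¬ s'.hasVoted ∧ out = []) ∧
    (∀ m ∈ out, s'.hasVoted ∧ S.leader e = p ∧ ∃ pl,
      m = .propose e (newBlock s pl) s.locked ∨
      m = .signed p (.vote e (S.hash (newBlock s pl)))) ∧
    (∀ m ∈ out, ∀ m' ∈ out, ∀ h h', m = .signed p (.vote e h) → m' = .signed p (.vote e h') →
      h = h') := by
  cases h with
  | follower hp =>
    simp only [enter, Function.update_apply]
    grind
  | propose hp hs pl =>
    simp only [enter, proposal, newBlock, hp, Function.update_apply]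
    grind
  | wait hp hs =>
    simp only [enter, hp, Function.update_apply]
    grind

/-- A proposing leader has to pick a payload. If `P` were empty, the rules for block certificates
could be blocked, and `Quiet` would not show that they have been executed. -/
theorem StartEpoch.exists [Nonempty P] (S : System n P H) (p : Fin n) (now : ℝ) (e : ℕ)
    (s : Local n P H) : ∃ s' out, S.StartEpoch p now e s s' out := by
  obtain ⟨pl⟩ := ‹Nonempty P›
  by_cases hp : S.leader e = p
  · by_cases hs : ProposesAtOnce s e
    · exact ⟨_, _, .propose hp hs pl⟩
    · exact ⟨_, _, .wait hp hs⟩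
  · exact ⟨_, _, .follower hp⟩

end StartEpoch

/-! ### What a settled replica cannot have overlooked -/

section Settled

variable {p : Fin n}

theorem Settled.epoch_ne [Nonempty P] (h : Settled S C p) {c : BlockCert n H}
    (hc : S.HasBlockCert (C.loc p).log c) : c.epoch ≠ (C.loc p).epoch := by
  intro he
  by_cases hact : (C.loc p).status (C.loc p).epoch = some .active
  · obtain ⟨s', out, hs⟩ := StartEpoch.exists S p C.now ((C.loc p).epoch + 1)
      { C.loc p with
        locked := some c
        timers := insert (.commit (C.loc p).epoch (some c.id), C.now + 2 * S.ΔS)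
          (C.loc p).timers }
    exact h.2 _ _ (.blockCertActive c hc he hact s' out hs)
  · obtain ⟨s', out, hs⟩ := StartEpoch.exists S p C.now ((C.loc p).epoch + 1)
      { C.loc p with locked := some c }
    exact h.2 _ _ (.blockCertInactive c hc he hact s' out hs)

theorem Settled.not_active (h : Settled S C p) {c : Cert n H}
    (hc : S.HasMisbehavior (C.loc p).log c) : (C.loc p).status c.epoch ≠ some .active := by
  intro hact
  by_cases he : c.epoch = (C.loc p).epoch
  · exact h.2 _ _ (.misbehaviorCurrent c hc he hact)
  · exact h.2 _ _ (.misbehaviorOther c hc he hact)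

theorem Settled.epoch_ne_of_quitBlock [Nonempty P] (h : Settled S C p) {r : Fin n}
    {c : BlockCert n H} {t : ℝ} (hv : S.ValidBlockCert c) (hq : QuitBlock C r c t)
    (ht : t + S.ΔS ≤ C.now) : c.epoch ≠ (C.loc p).epoch :=
  h.epoch_ne ⟨hv, .inl (h.1 _ _ _ hq ht)⟩

theorem Settled.epoch_ne_of_voted [Nonempty P] (h : Settled S C p) (hn : 2 * S.f < n)
    (hfaulty : S.faulty.card ≤ S.f) {e : ℕ} {i : H}
    (hv : ∀ r, S.Honest r → ∃ t, Voted C r e i t ∧ t + S.ΔS ≤ C.now) :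
    e ≠ (C.loc p).epoch := by
  -- The honest replicas alone suffice as signers: there are at least `n - f ≥ f + 1` of them.
  refine h.epoch_ne (c := ⟨e, i, S.faultyᶜ⟩) ⟨?_, .inr fun q hq => ?_⟩
  · simp only [ValidBlockCert, Finset.card_compl, Fintype.card_fin]
    omega
  · obtain ⟨t, hvt, ht⟩ := hv q (by simpa [Honest] using hq)
    exact h.1 _ _ _ hvt ht

theorem Settled.not_active_of_quitMis (h : Settled S C p) {r : Fin n} {e : ℕ} {t : ℝ}
    (hq : QuitMis S C r e t) (ht : t + S.ΔS ≤ C.now) : (C.loc p).status e ≠ some .active := by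
  obtain ⟨c, hv, rfl, hs⟩ := hq
  exact h.not_active ⟨hv, .inl (h.1 _ _ _ hs ht)⟩

theorem Settled.not_active_of_votes (h : Settled S C p) {r r' : Fin n} {e : ℕ} {i i' : H}
    {t t' : ℝ} (hi : i ≠ i')
    (hr : (r, .signed (S.leader e) (.vote e i), t) ∈ C.sent) (ht : t + S.ΔS ≤ C.now)
    (hr' : (r', .signed (S.leader e) (.vote e i'), t') ∈ C.sent) (ht' : t' + S.ΔS ≤ C.now) :
    (C.loc p).status e ≠ some .active := by
  refine h.not_active (c := .equiv (S.leader e) e i i') ⟨⟨rfl, hi⟩, .inr fun x hx => ?_⟩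
  rcases hx with rfl | rfl
  · exact h.1 _ _ _ hr ht
  · exact h.1 _ _ _ hr' ht'

end Settled

theorem ValidBlockCert.exists_honest (hfaulty : S.faulty.card ≤ S.f) {c : BlockCert n H}
    (hc : S.ValidBlockCert c) : ∃ r ∈ c.signers, S.Honest r := by
  by_contra! hcon
  have := Finset.card_le_card (s := c.signers) (t := S.faulty)
    fun r hr => not_not.mp (hcon r hr)
  have : S.f + 1 ≤ c.signers.card := hc
  omega

/-! ### Invariants of a local state -/

/-- Bookkeeping facts about the local state `s` of an honest replica `q`. -/
structure LocalInv (S : System n P H) (q : Fin n) (s : Local n P H) : Prop where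
  unbooted : ¬ s.booted → s.epoch = 0 ∧ s.timers = ∅
  status_le : ∀ e, s.status e ≠ none → s.booted ∧ e ≤ s.epoch
  status_epoch : s.booted → s.status s.epoch ≠ none
  committed : s.status s.epoch = some .committed →
    ∃ h, AllVotes s.log s.epoch h
  notCommitted : s.status s.epoch = some .notCommitted →
    ∃ d, (.commit s.epoch none, d) ∈ s.timers
  decision : ∀ e h, s.decision e = some h → s.status e = some .committed
  ledger : ∀ b ∈ s.ledger, ∃ e d, s.decision e = some (S.hash d) ∧ Ancestor S.hash b d
  commit_some : ∀ e h d, (.commit e (some h), d) ∈ s.timers → e < s.epoch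
  epochChange : ∀ e d, (.epochChange e, d) ∈ s.timers → e ≤ s.epoch ∧ S.leader e = q
  epochChange_unique : ∀ e d d', (.epochChange e, d) ∈ s.timers → (.epochChange e, d') ∈ s.timers →
    d = d'

theorem LocalInv.initial (S : System n P H) (q : Fin n) : LocalInv S q (Local.initial n P H) := by
  constructor <;> simp [Local.initial]

theorem LocalInv.startEpoch {q : Fin n} {s s' : Local n P H} {out : List (Msg n P H)} {now : ℝ}
    {e : ℕ} (h : S.StartEpoch q now e s s' out) (hb : s.booted)
    (hst : ∀ e', s.status e' ≠ none → e' < e)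
    (hdec : ∀ e h, s.decision e = some h → s.status e = some .committed)
    (hled : ∀ b ∈ s.ledger, ∃ e d, s.decision e = some (S.hash d) ∧ Ancestor S.hash b d)
    (hcs : ∀ e' h d, (.commit e' (some h), d) ∈ s.timers → e' < e)
    (hec : ∀ e' d, (.epochChange e', d) ∈ s.timers → e' < e ∧ S.leader e' = q)
    (hecu : ∀ e d d', (.epochChange e, d) ∈ s.timers → (.epochChange e, d') ∈ s.timers → d = d') :
    LocalInv S q s' := by
  obtain ⟨h1, h2, h3, h4, h5, h6, h7, h8, h9, h10, -, -⟩ := h.spec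
  -- Starting `e` resets its decision. Nothing is lost, since decided epochs were started before and
  -- hence differ from `e`.
  have hne : ∀ e' h, s.decision e' = some h → e' ≠ e := by
    rintro e' h hd rfl
    exact lt_irrefl _ (hst e' (by simp [hdec _ _ hd]))
  constructor
  · grind
  · grind [Function.update_apply]
  · grind [Function.update_apply]
  · grind [Function.update_apply]
  · grind [Function.update_apply]
  · grind [Function.update_apply]
  · intro b hb
    obtain ⟨e', d, hd, ha⟩ := hled b (h7 ▸ hb)
    exact ⟨e', d, by rw [h5, if_neg (hne _ _ hd), hd], ha⟩
  · grind
  · grind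
  · grind

/-- The regular commit rule acts only on epochs already left, by the field `commit_some`. This is
why a committed current epoch must stem from the fast rule, with all votes in the log. -/
theorem LocalInv.act {p : Fin n} {s' : Local n P H} {out : List (Msg n P H)}
    (hi : LocalInv S p (C.loc p)) (ha : Act S C p s' out) : LocalInv S p s' := by
  obtain ⟨i1, i2, i3, i4, i5, i6, i7, i8, i9, i10⟩ := hi
  have hlast : ∀ e h, (C.loc p).status e = some .active → (C.loc p).decision e ≠ some h := by
    intro e h h1 h2
    simp [i6 _ _ h2] at h1
  have hled : ∀ e (h : H), (C.loc p).status e = some .active → ∀ b ∈ (C.loc p).ledger, ∃ e' d,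
      Function.update (C.loc p).decision e (some h) e' = some (S.hash d) ∧
        Ancestor S.hash b d := by
    intro e h hact b hb
    obtain ⟨e', d, hd, ha⟩ := i7 b hb
    refine ⟨e', d, ?_, ha⟩
    rwa [Function.update_of_ne]
    rintro rfl
    exact hlast _ _ hact hd
  cases ha with
  | boot hb ht s' out hs =>
    have := i1 hb
    exact LocalInv.startEpoch hs trivial (by grind) i6 i7 (by grind) (by grind) (by grind)
  | receive m hm =>
    have := fun e h (ha : AllVotes (C.loc p).log e h) => ha.mono (Set.subset_insert m _)
    constructor <;> grind
  | act hb s' out hs =>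
    cases hs with
    | vote b bc hprop hlead hact hvote hacc => constructor <;> grind
    | blockCertActive c hc he hact s' out hs =>
      exact LocalInv.startEpoch hs hb (by grind) i6 i7 (by grind) (by grind) (by grind)
    | blockCertInactive c hc he hact s' out hs =>
      exact LocalInv.startEpoch hs hb (by grind) i6 i7 (by grind) (by grind) (by grind)
    | blockCertLeader c hc he hp hl => constructor <;> grind
    | fastCommit hfast e h hall hact =>
      have := hled e h hact
      have hall' : AllVotes (C.loc p).log e h := hall
      constructor <;> grind [Function.update_apply]
    | misbehaviorCurrent c hc he hact =>
      constructor <;> grind [Function.update_apply]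
    | misbehaviorOther c hc he hact =>
      constructor <;> grind [Function.update_apply]
    | commitBlock e b bc hprop hdec hnew =>
      constructor <;> grind
  | expire τ hτ hset s' out hs =>
    cases hs with
    | propose e he pl => constructor <;> grind
    | proposeStale e he => constructor <;> grind
    | silence e he => constructor <;> grind
    | silenceStale e he => constructor <;> grind
    | commit e h hact =>
      have := hled e h hact
      constructor <;> grind [Function.update_apply]
    | commitNot e h hact => constructor <;> grind
    | nextEpoch e he s' out hs =>
      have hb : (C.loc p).booted := by
        by_contra hb
        simp [(i1 hb).2] at hτ
      exact LocalInv.startEpoch hs hb (by grind) i6 i7 (by grind) (by grind) (by grind)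
    | nextEpochStale e he => constructor <;> grind

theorem Reachable.localInv (hC : S.Reachable C) (q : Fin n) :
    LocalInv S q (C.loc q) := by
  refine Reachable.rec_on (Q := fun C => LocalInv S q (C.loc q)) (LocalInv.initial S q) ?_ ?_ hC
  · intro C p s' out _ ih _ ha
    rw [update_loc]
    split_ifs with h
    · subst h
      exact ih.act ha
    · exact ih
  · exact fun C t' _ ih _ => ih

/-! ### What a single step may change -/

/-- How the epoch of a replica may change in one of its steps. -/
inductive EpochChange (S : System n P H) (C : Config n P H) (p : Fin n) (s' : Local n P H)
    (out : List (Msg n P H)) : Prop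
  | same (he : s'.epoch = (C.loc p).epoch) (hb : s'.booted ↔ (C.loc p).booted)
      (hl : s'.locked = (C.loc p).locked ∨ ∃ c, s'.locked = some c ∧ .quit (.block c) ∈ out ∧
        ∀ l, (C.loc p).locked = some l → l.epoch < c.epoch)
  | boot (he : s'.epoch = 0) (hb : ¬ (C.loc p).booted) (hb' : s'.booted) (ht : C.now = S.start p)
      (hl : s'.locked = (C.loc p).locked)
  | cert (he : s'.epoch = (C.loc p).epoch + 1) (hb : (C.loc p).booted) (hb' : s'.booted)
      (c : BlockCert n H) (hc : .quit (.block c) ∈ out) (hce : c.epoch = (C.loc p).epoch)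
      (hl : s'.locked = some c)
  | timer (he : s'.epoch = (C.loc p).epoch + 1) (hb : (C.loc p).booted) (hb' : s'.booted)
      (hτ : (.commit (C.loc p).epoch none, C.now) ∈ (C.loc p).timers) (hset : Settled S C p)
      (hl : s'.locked = (C.loc p).locked)

/-- The circumstances in which a replica broadcasts a vote for `h` in epoch `e`. -/
inductive VoteCause (S : System n P H) (C : Config n P H) (p : Fin n) (s' : Local n P H)
    (e : ℕ) (h : H) : Prop
  | propose (hp : S.leader e = p) (pl : P) (hh : h = S.hash (newBlock s' pl))
      (hnew : (C.loc p).epoch < e ∨ ¬ (C.loc p).booted ∨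
        (C.loc p).epoch = e ∧ ∃ d, (.epochChange e, d) ∈ (C.loc p).timers)
      (hτ : ∀ d, (.epochChange e, d) ∉ s'.timers)
  | vote (b : Block P H) (bc : Option (BlockCert n H)) (hh : h = S.hash b)
      (hb : (C.loc p).booted) (he : (C.loc p).epoch = e) (hv : ¬ (C.loc p).hasVoted)
      (hprop : .propose e b bc ∈ (C.loc p).log)
      (hlead : .signed (S.leader e) (.vote e h) ∈ (C.loc p).log)
      (hacc : S.Accepts (C.loc p) b bc) (hτ : s'.timers = (C.loc p).timers)

/-- What a single step of a replica may change. -/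
structure ActSpec (S : System n P H) (C : Config n P H) (p : Fin n) (s' : Local n P H)
    (out : List (Msg n P H)) : Prop where
  epoch : EpochChange S C p s' out
  log : ∀ m ∈ s'.log, m ∈ (C.loc p).log ∨ S.Genuine C m
  hasVoted : (C.loc p).hasVoted → s'.epoch = (C.loc p).epoch → (C.loc p).booted → s'.hasVoted
  voted : ∀ e h, .signed p (.vote e h) ∈ out → s'.epoch = e ∧ s'.hasVoted ∧ s'.booted ∧
    .signed (S.leader e) (.vote e h) ∈ out ∧ VoteCause S C p s' e h
  voted_unique : ∀ e h h', .signed p (.vote e h) ∈ out → .signed p (.vote e h') ∈ out → h = h'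
  quitBlock : ∀ c, .quit (.block c) ∈ out → S.HasBlockCert (C.loc p).log c
  quitMis : ∀ c, .quit c ∈ out → S.ValidMisbehavior c →
    (C.loc p).booted ∧ (C.loc p).epoch = c.epoch
  commit_none : ∀ e d, (.commit e none, d) ∈ s'.timers → (.commit e none, d) ∈ (C.loc p).timers ∨
    d = C.now + 2 * S.ΔS ∧ ∃ c, S.ValidMisbehavior c ∧ c.epoch = e ∧ .quit c ∈ out
  commit_some : ∀ e h d, (.commit e (some h), d) ∈ s'.timers →
    (.commit e (some h), d) ∈ (C.loc p).timers ∨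
      d = C.now + 2 * S.ΔS ∧ ∃ c, c.epoch = e ∧ c.id = h ∧ .quit (.block c) ∈ out
  epochChange : ∀ e d, (.epochChange e, d) ∈ s'.timers → (.epochChange e, d) ∈ (C.loc p).timers ∨
    e = s'.epoch ∧ ((C.loc p).epoch < e ∨ ¬ (C.loc p).booted)
  commit_keep : ∀ e d, (.commit e none, d) ∈ (C.loc p).timers →
    (.commit e none, d) ∈ s'.timers ∨ ((C.loc p).epoch = e → s'.epoch = e + 1)
  status : ∀ e, s'.status e = some .active → (C.loc p).status e = some .active ∨
    s'.epoch = e ∧ ((C.loc p).epoch < e ∨ ¬ (C.loc p).booted)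
  decision : ∀ e h, s'.decision e = some h → (C.loc p).decision e = some h ∨
    (C.loc p).status e = some .active ∧ (AllVotes (C.loc p).log e h ∨
      (.commit e (some h), C.now) ∈ (C.loc p).timers ∧ Settled S C p)

/-- Common part of all rules that start an epoch; `pre` is what the rule broadcasts ahead of
`StartEpoch`. -/
theorem ActSpec.startEpoch {p : Fin n} {s s' : Local n P H} {pre out : List (Msg n P H)} {e : ℕ}
    (hi : LocalInv S p (C.loc p)) (h : S.StartEpoch p C.now e s s' out)
    (hepoch : EpochChange S C p s' (pre ++ out))
    (hpre : ∀ m ∈ pre, ∃ c, m = .quit (.block c) ∧ S.HasBlockCert (C.loc p).log c)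
    (hnew : (C.loc p).epoch < e ∨ ¬ (C.loc p).booted) (hb : s.booted)
    (hlog : s.log = (C.loc p).log) (hstatus : s.status = (C.loc p).status)
    (hdec : s.decision = (C.loc p).decision)
    (hec : ∀ e d, (.epochChange e, d) ∈ s.timers → (.epochChange e, d) ∈ (C.loc p).timers)
    (hcn : ∀ e d, (.commit e none, d) ∈ s.timers → (.commit e none, d) ∈ (C.loc p).timers)
    (hcs : ∀ e i d, (.commit e (some i), d) ∈ s.timers →
      (.commit e (some i), d) ∈ (C.loc p).timers ∨
        d = C.now + 2 * S.ΔS ∧ ∃ c, c.epoch = e ∧ c.id = i ∧ .quit (.block c) ∈ pre)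
    (hkeep : ∀ e' d, (.commit e' none, d) ∈ (C.loc p).timers →
      (.commit e' none, d) ∈ s.timers ∨ ((C.loc p).epoch = e' → e = e' + 1)) :
    ActSpec S C p s' (pre ++ out) := by
  obtain ⟨h1, h2, h3, h4, h5, h6, -, h8, h9, h10, h11, h12⟩ := h.spec
  have i1 := hi.unbooted
  have i2 := hi.epochChange
  have hblock : ∀ pl, newBlock s' pl = newBlock s pl := fun pl => by simp [newBlock, h3]
  have hcause : ∀ e' i, .signed p (.vote e' i) ∈ pre ++ out → e' = e ∧ s'.hasVoted ∧
      VoteCause S C p s' e i := by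
    intro e' i hm
    rcases List.mem_append.mp hm with hm | hm
    · grind
    · obtain ⟨hv, hl, pl, hpl⟩ := h11 _ hm
      obtain ⟨rfl, rfl⟩ : e' = e ∧ i = S.hash (newBlock s pl) := by grind
      refine ⟨rfl, hv, .propose hl pl (by rw [hblock]) (by grind) ?_⟩
      intro d hd
      rcases h10 _ _ hd with hd | hd
      · have hd' := hec _ _ hd
        rcases hnew with hnew | hnew
        · exact absurd (i2 _ _ hd').1 (by omega)
        · simp [(i1 hnew).2] at hd'
      · exact hd.2.2.2.1 hv
  constructor
  · exact hepoch
  · grind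
  · grind
  · intro e' i hm
    obtain ⟨rfl, hv, hc⟩ := hcause e' i hm
    refine ⟨h1, hv, h2 ▸ hb, ?_, hc⟩
    rcases List.mem_append.mp hm with hm' | hm'
    · grind
    · rwa [(h11 _ hm').2.1]
  · intro e' i i' hm hm'
    obtain ⟨rfl, -⟩ := hcause e' i hm
    refine h12 _ ?_ _ ?_ i i' rfl rfl <;> grind
  · intro c hm
    rcases List.mem_append.mp hm with hm' | hm'
    · grind
    · grind
  · intro c hm hv
    rcases List.mem_append.mp hm with hm' | hm'
    · obtain ⟨c', hc', -⟩ := hpre _ hm'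
      cases hc'
      exact hv.elim
    · grind
  · grind
  · grind
  · grind
  · grind
  · grind
  · grind

theorem Act.spec {p : Fin n} {s' : Local n P H} {out : List (Msg n P H)}
    (hi : LocalInv S p (C.loc p)) (ha : Act S C p s' out) : ActSpec S C p s' out := by
  cases ha with
  | boot hb ht s' out hs =>
    obtain ⟨h1, h2, h3, -⟩ := hs.spec
    exact ActSpec.startEpoch (pre := []) hi hs (.boot h1 hb (h2 ▸ trivial) ht h3) (by simp)
      (.inr hb) trivial rfl rfl rfl (by simp) (by simp) (fun _ _ _ h => .inl h)
      (fun _ _ h => .inl h)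
  | receive m hm =>
    constructor
    · exact .same rfl .rfl (.inl rfl)
    all_goals grind
  | act hb s' out hs =>
    cases hs with
    | vote b bc hprop hlead hact hvote hacc =>
      have hc : VoteCause S C p { C.loc p with hasVoted := True } (C.loc p).epoch (S.hash b) :=
        .vote b bc rfl hb rfl hvote hprop hlead hacc rfl
      constructor
      · exact .same rfl .rfl (.inl rfl)
      all_goals grind
    | blockCertActive c hc he hact s' out hs =>
      obtain ⟨h1, h2, h3, -⟩ := hs.spec
      exact ActSpec.startEpoch (pre := [.quit (.block c)]) hi hs
        (.cert h1 hb (h2 ▸ hb) c (by simp) he h3) (by simpa using hc)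
        (.inl (Nat.lt_succ_self _)) hb rfl rfl rfl (by simp) (by simp) (by grind) (by grind)
    | blockCertInactive c hc he hact s' out hs =>
      obtain ⟨h1, h2, h3, -⟩ := hs.spec
      exact ActSpec.startEpoch (pre := [.quit (.block c)]) hi hs
        (.cert h1 hb (h2 ▸ hb) c (by simp) he h3) (by simpa using hc)
        (.inl (Nat.lt_succ_self _)) hb rfl rfl rfl (by simp) (by simp) (by grind) (by grind)
    | blockCertLeader c hc he hp hl =>
      constructor
      · exact .same rfl .rfl (.inr ⟨c, rfl, by simp, hl⟩)
      all_goals grind [ValidMisbehavior]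
    | fastCommit hfast e h hall hact =>
      have hall' : AllVotes (C.loc p).log e h := hall
      constructor
      · exact .same rfl .rfl (.inl rfl)
      all_goals grind [Function.update_apply]
    | misbehaviorCurrent c hc he hact =>
      have hv := hc.1
      constructor
      · exact .same rfl .rfl (.inl rfl)
      all_goals grind [Function.update_apply, ValidMisbehavior]
    | misbehaviorOther c hc he hact =>
      constructor
      · exact .same rfl .rfl (.inl rfl)
      all_goals grind [Function.update_apply]
    | commitBlock e b bc hprop hdec hnew =>
      constructor
      · exact .same rfl .rfl (.inl rfl)
      all_goals grind
  | expire τ hτ hset s' out hs =>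
    cases hs with
    | propose e he pl =>
      obtain rfl : (C.loc p).epoch = e := he
      have hb : (C.loc p).booted := by
        by_contra hb
        simp [(hi.unbooted hb).2] at hτ
      have i2 := hi.epochChange_unique
      have hl := (hi.epochChange _ _ hτ).2
      have hc : VoteCause S C p
          { C.loc p with
            timers := (C.loc p).timers \ {(.epochChange (C.loc p).epoch, C.now)}
            hasVoted := True }
          (C.loc p).epoch (S.hash (newBlock (C.loc p) pl)) :=
        .propose hl pl rfl (by grind) (by grind)
      have hblock : ∀ s : Local n P H, s.locked = (C.loc p).locked →
          newBlock s pl = newBlock (C.loc p) pl := fun s hs => by simp [newBlock, hs]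
      constructor
      · exact .same rfl .rfl (.inl rfl)
      all_goals grind [proposal]
    | proposeStale e he =>
      constructor
      · exact .same rfl .rfl (.inl rfl)
      all_goals grind
    | silence e he =>
      constructor
      · exact .same rfl .rfl (.inl rfl)
      all_goals grind
    | silenceStale e he =>
      constructor
      · exact .same rfl .rfl (.inl rfl)
      all_goals grind
    | commit e h hact =>
      constructor
      · exact .same rfl .rfl (.inl rfl)
      all_goals grind [Function.update_apply]
    | commitNot e h hact =>
      constructor
      · exact .same rfl .rfl (.inl rfl)
      all_goals grind
    | nextEpoch e he s' out hs =>
      have hb : (C.loc p).booted := by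
        by_contra hb
        simp [(hi.unbooted hb).2] at hτ
      obtain ⟨h1, h2, h3, -⟩ := hs.spec
      obtain rfl : (C.loc p).epoch = e := he
      exact ActSpec.startEpoch (pre := []) hi hs
        (.timer h1 hb (h2 ▸ hb) hτ hset h3) (by simp)
        (.inl (Nat.lt_succ_self _)) hb rfl rfl rfl (by grind) (by grind) (by grind) (by grind)
    | nextEpochStale e he =>
      constructor
      · exact .same rfl .rfl (.inl rfl)
      all_goals grind

theorem Reachable.rec_spec {Q : Config n P H → Prop} (init : Q (initial n P H))
    (act : ∀ C p s' out, S.Reachable C → S.Reachable (update C p s' out) → Q C → S.Honest p →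
      ActSpec S C p s' out → Q (update C p s' out))
    (tick : ∀ C t', S.Reachable C → S.Reachable { C with now := t' } → Q C → Tick S C t' →
      Q { C with now := t' })
    (hC : S.Reachable C) : Q C :=
  hC.rec_on init
    (fun C p s' out hC hQ hp ha =>
      act C p s' out hC (hC.after_act hp ha) hQ hp (ha.spec (hC.localInv p)))
    (fun C t' hC hQ ht => tick C t' hC (hC.after_tick ht) hQ ht)

/-! ### Origin of signatures, certificates and timers -/

section Monotone

variable {p q : Fin n} {s' : Local n P H} {out : List (Msg n P H)}

theorem voted_update {e : ℕ} {h : H} {t : ℝ} : Voted (update C p s' out) q e h t ↔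
    Voted C q e h t ∨ q = p ∧ .signed q (.vote e h) ∈ out ∧ t = C.now :=
  mem_update_sent

theorem quitBlock_update {c : BlockCert n H} {t : ℝ} : QuitBlock (update C p s' out) q c t ↔
    QuitBlock C q c t ∨ q = p ∧ .quit (.block c) ∈ out ∧ t = C.now :=
  mem_update_sent

theorem quitMis_update {e : ℕ} {t : ℝ} : QuitMis S (update C p s' out) q e t ↔
    QuitMis S C q e t ∨
      q = p ∧ t = C.now ∧ ∃ c, S.ValidMisbehavior c ∧ c.epoch = e ∧ .quit c ∈ out := by
  simp only [QuitMis, mem_update_sent]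
  grind

end Monotone

theorem Reachable.sent (hC : S.Reachable C) {q : Fin n} {m : Msg n P H} {t : ℝ}
    (hm : (q, m, t) ∈ C.sent) : S.Honest q ∧ t ≤ C.now := by
  refine hC.rec_spec (Q := fun C => ∀ q m t, (q, m, t) ∈ C.sent → S.Honest q ∧ t ≤ C.now)
    (by simp [initial]) ?_ ?_ q m t hm
  · intro C p s' out _ _ ih hp _ q m t hm
    rcases mem_update_sent.mp hm with h | ⟨rfl, -, rfl⟩
    · exact ih q m t h
    · exact ⟨hp, le_rfl⟩
  · intro C t' _ _ ih ht q m t hm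
    exact ⟨(ih q m t hm).1, (ih q m t hm).2.trans ht.lt.le⟩

theorem Genuine.after_act {m : Msg n P H} (hm : S.Genuine C m) (p : Fin n) (s' : Local n P H)
    (out : List (Msg n P H)) : S.Genuine (update C p s' out) m := by
  intro x hx hh
  obtain ⟨t, ht⟩ := hm x hx hh
  exact ⟨t, mem_update_sent.mpr (.inl ht)⟩

theorem Reachable.genuine (hC : S.Reachable C) {q : Fin n} {m : Msg n P H}
    (hm : m ∈ (C.loc q).log) : S.Genuine C m := by
  refine hC.rec_spec (Q := fun C => ∀ q m, m ∈ (C.loc q).log → S.Genuine C m)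
    (by simp [initial, Local.initial]) ?_ ?_ q m hm
  · intro C p s' out _ _ ih _ ha q m hm
    refine Genuine.after_act ?_ p s' out
    rw [update_loc] at hm
    split_ifs at hm with h
    · exact (ha.log m hm).elim (ih p m) id
    · exact ih q m hm
  · exact fun C t' _ _ ih _ q m hm => ih q m hm

theorem Reachable.voted_of_mem_log (hC : S.Reachable C) {q r : Fin n} {e : ℕ} {h : H}
    (hr : S.Honest r) (hm : .signed r (.vote e h) ∈ (C.loc q).log) :
    ∃ t ≤ C.now, Voted C r e h t := by
  obtain ⟨t, ht⟩ := hC.genuine hm (r, .vote e h) (by simp [Msg.sigs]) hr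
  exact ⟨t, (hC.sent ht).2, ht⟩

/-- Some honest replica voted for `h` in epoch `e` by time `t`. -/
def Backed (S : System n P H) (C : Config n P H) (e : ℕ) (h : H) (t : ℝ) : Prop :=
  ∃ r, S.Honest r ∧ ∃ t' ≤ t, Voted C r e h t'

theorem Backed.after_act {e : ℕ} {h : H} {t t' : ℝ} (hb : Backed S C e h t) (htt : t ≤ t')
    (p : Fin n) (s' : Local n P H) (out : List (Msg n P H)) :
    Backed S (update C p s' out) e h t' := by
  obtain ⟨r, hr, u, hu, hv⟩ := hb
  exact ⟨r, hr, u, hu.trans htt, voted_update.mpr (.inl hv)⟩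

theorem Reachable.backed_of_sigs (hC : S.Reachable C) (hfaulty : S.faulty.card ≤ S.f)
    {c : BlockCert n H} {m : Msg n P H} {q : Fin n} (hv : S.ValidBlockCert c)
    (hm : m ∈ (C.loc q).log) (hs : c.sigs ⊆ m.sigs) : Backed S C c.epoch c.id C.now := by
  obtain ⟨r, hr, hh⟩ := hv.exists_honest hfaulty
  obtain ⟨t, ht⟩ := hC.genuine hm (r, .vote c.epoch c.id) (hs ⟨hr, rfl⟩) hh
  exact ⟨r, hh, t, (hC.sent ht).2, ht⟩

theorem Reachable.backed_of_hasBlockCert (hC : S.Reachable C) (hfaulty : S.faulty.card ≤ S.f)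
    {c : BlockCert n H} {q : Fin n} (hc : S.HasBlockCert (C.loc q).log c) :
    Backed S C c.epoch c.id C.now := by
  rcases hc with ⟨hv, hm | hm⟩
  · exact hC.backed_of_sigs hfaulty hv hm subset_rfl
  · obtain ⟨r, hr, hh⟩ := hv.exists_honest hfaulty
    obtain ⟨t, ht, hvt⟩ := hC.voted_of_mem_log hh (hm r hr)
    exact ⟨r, hh, t, ht, hvt⟩

theorem Reachable.quitBlock (hC : S.Reachable C) (hfaulty : S.faulty.card ≤ S.f)
    {q : Fin n} {c : BlockCert n H} {t : ℝ} (hq : QuitBlock C q c t) :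
    S.ValidBlockCert c ∧ Backed S C c.epoch c.id t := by
  refine hC.rec_spec
    (Q := fun C => ∀ q c t, QuitBlock C q c t → S.ValidBlockCert c ∧ Backed S C c.epoch c.id t)
    (by simp [initial, QuitBlock]) ?_ ?_ q c t hq
  · intro C p s' out hC _ ih _ ha q c t hq
    rcases quitBlock_update.mp hq with h | ⟨rfl, hm, rfl⟩
    · exact ⟨(ih q c t h).1, (ih q c t h).2.after_act le_rfl _ _ _⟩
    · have := ha.quitBlock c hm
      exact ⟨this.1, (hC.backed_of_hasBlockCert hfaulty this).after_act le_rfl _ _ _⟩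
  · exact fun C t' _ _ ih _ => ih

theorem ActSpec.backed_locked (hC : S.Reachable C) (hfaulty : S.faulty.card ≤ S.f) {p : Fin n}
    {s' : Local n P H} {out : List (Msg n P H)} (ha : ActSpec S C p s' out)
    (hold : ∀ l, (C.loc p).locked = some l → Backed S C l.epoch l.id C.now)
    {l : BlockCert n H} (hl : s'.locked = some l) : Backed S C l.epoch l.id C.now := by
  have hnew : .quit (.block l) ∈ out → Backed S C l.epoch l.id C.now := fun hm =>
    hC.backed_of_hasBlockCert hfaulty (ha.quitBlock l hm)
  cases ha.epoch <;> grind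

theorem Reachable.backed_locked (hC : S.Reachable C) (hfaulty : S.faulty.card ≤ S.f)
    {q : Fin n} {l : BlockCert n H} (hl : (C.loc q).locked = some l) :
    Backed S C l.epoch l.id C.now := by
  refine hC.rec_spec
    (Q := fun C => ∀ q l, (C.loc q).locked = some l → Backed S C l.epoch l.id C.now)
    (by simp [initial, Local.initial]) ?_ ?_ q l hl
  · intro C p s' out hC _ ih _ ha q l hl
    refine Backed.after_act (t := C.now) ?_ le_rfl p s' out
    rw [update_loc] at hl
    split_ifs at hl with h
    · exact ha.backed_locked hC hfaulty (ih p) hl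
    · exact ih q l hl
  · intro C t' _ _ ih ht q l hl
    obtain ⟨r, hr, u, hu, hv⟩ := ih q l hl
    exact ⟨r, hr, u, hu.trans ht.lt.le, hv⟩

/-- A commit timer is started together with the broadcast of its certificate and runs for `2ΔS`, so
its expiry time dates that broadcast. -/
theorem Reachable.commit_none (hC : S.Reachable C) {q : Fin n} {e : ℕ} {d : ℝ}
    (hd : (.commit e none, d) ∈ (C.loc q).timers) : QuitMis S C q e (d - 2 * S.ΔS) := by
  refine hC.rec_spec (Q := fun C => ∀ q e d, (.commit e none, d) ∈ (C.loc q).timers →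
    QuitMis S C q e (d - 2 * S.ΔS)) (by simp [initial, Local.initial]) ?_ ?_ q e d hd
  · intro C p s' out _ _ ih _ ha q e d hd
    rw [quitMis_update]
    rw [update_loc] at hd
    split_ifs at hd with h
    · subst h
      rcases ha.commit_none e d hd with hd | ⟨rfl, hc⟩
      · exact .inl (ih q e d hd)
      · exact .inr ⟨rfl, by ring, hc⟩
    · exact .inl (ih q e d hd)
  · exact fun C t' _ _ ih _ => ih

theorem Reachable.commit_some (hC : S.Reachable C) {q : Fin n} {e : ℕ} {h : H} {d : ℝ}
    (hd : (.commit e (some h), d) ∈ (C.loc q).timers) :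
    ∃ c, c.epoch = e ∧ c.id = h ∧ QuitBlock C q c (d - 2 * S.ΔS) := by
  refine hC.rec_spec (Q := fun C => ∀ q e h d, (.commit e (some h), d) ∈ (C.loc q).timers →
    ∃ c, c.epoch = e ∧ c.id = h ∧ QuitBlock C q c (d - 2 * S.ΔS))
    (by simp [initial, Local.initial]) ?_ ?_ q e h d hd
  · intro C p s' out _ _ ih _ ha q e h d hd
    simp only [quitBlock_update]
    rw [update_loc] at hd
    split_ifs at hd with hqp
    · subst hqp
      rcases ha.commit_some e h d hd with hd | ⟨rfl, c, hce, hci, hc⟩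
      · obtain ⟨c, hce, hci, hc⟩ := ih q e h d hd
        exact ⟨c, hce, hci, .inl hc⟩
      · exact ⟨c, hce, hci, .inr ⟨rfl, hc, by ring⟩⟩
    · obtain ⟨c, hce, hci, hc⟩ := ih q e h d hd
      exact ⟨c, hce, hci, .inl hc⟩
  · exact fun C t' _ _ ih _ => ih

/-! ### One vote per honest replica and epoch -/

theorem EpochChange.le {p : Fin n} {s' : Local n P H} {out : List (Msg n P H)}
    (hi : LocalInv S p (C.loc p)) (h : EpochChange S C p s' out) :
    (C.loc p).epoch ≤ s'.epoch ∧ ((C.loc p).booted → s'.booted) := by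
  have := hi.unbooted
  cases h <;> grind

/-- After a vote in the current epoch both ways to vote again are closed: the flag blocks the voting
rule, and no pending `epochChange` timer is left to trigger a proposal. -/
theorem Reachable.voted (hC : S.Reachable C) {q : Fin n} {e : ℕ} {h : H} {t : ℝ}
    (hv : Voted C q e h t) : (C.loc q).booted ∧ e ≤ (C.loc q).epoch ∧
      (e = (C.loc q).epoch →
        (C.loc q).hasVoted ∧ ∀ d, (.epochChange e, d) ∉ (C.loc q).timers) := by
  refine hC.rec_spec (Q := fun C => ∀ q e h t, Voted C q e h t →
    (C.loc q).booted ∧ e ≤ (C.loc q).epoch ∧ (e = (C.loc q).epoch →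
      (C.loc q).hasVoted ∧ ∀ d, (.epochChange e, d) ∉ (C.loc q).timers))
    (by simp [initial, Voted]) ?_ ?_ q e h t hv
  · intro C p s' out hC _ ih hp ha q e h t hv
    rw [update_loc]
    rcases voted_update.mp hv with hv | ⟨rfl, hm, rfl⟩
    · obtain ⟨h1, h2, h3⟩ := ih q e h t hv
      split_ifs with hqp
      · subst hqp
        obtain ⟨h4, h5⟩ := ha.epoch.le (hC.localInv q)
        refine ⟨h5 h1, h2.trans h4, fun he => ?_⟩
        have he' : e = (C.loc q).epoch := by omega
        refine ⟨ha.hasVoted (h3 he').1 (he ▸ he') h1, fun d hd => ?_⟩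
        have := ha.epochChange e d hd
        grind
      · exact ⟨h1, h2, h3⟩
    · rw [if_pos rfl]
      obtain ⟨rfl, h2, h3, -, h5⟩ := ha.voted e h hm
      refine ⟨h3, le_rfl, fun _ => ⟨h2, ?_⟩⟩
      cases h5 with
      | propose hp pl hh hnew hτ => exact hτ
      | vote b bc hh hb he hv hprop hlead hacc hτ =>
        -- A leader still waiting to propose cannot use the voting rule: this needs the leader's
        -- vote, which is its own and unforgeable, so the leader would have voted already.
        intro d hd
        have hl := ((hC.localInv q).epochChange _ d (hτ ▸ hd)).2
        rw [hl] at hlead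
        obtain ⟨t, -, ht⟩ := hC.voted_of_mem_log hp hlead
        exact hv ((ih q _ h t ht).2.2 he.symm).1
  · exact fun C t' _ _ ih _ => ih

theorem Reachable.voted_unique (hC : S.Reachable C) {q : Fin n} {e : ℕ} {h h' : H} {t t' : ℝ}
    (hv : Voted C q e h t) (hv' : Voted C q e h' t') : h = h' := by
  refine hC.rec_spec (Q := fun C => ∀ q e h h' t t', Voted C q e h t → Voted C q e h' t' → h = h')
    (by simp [initial, Voted]) ?_ ?_ q e h h' t t' hv hv'
  · intro C p s' out hC _ ih hp ha q e h h' t t' hv hv'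
    have key : ∀ h h' t, Voted C p e h t → .signed p (.vote e h') ∈ out → False := by
      intro h h' t hv hm
      obtain ⟨h1, h2, h3⟩ := hC.voted hv
      cases (ha.voted e h' hm).2.2.2.2 <;> grind
    rcases voted_update.mp hv with ho | ⟨hqp, hm, -⟩ <;>
      rcases voted_update.mp hv' with ho' | ⟨hqp, hm', -⟩
    · exact ih q e h h' t t' ho ho'
    all_goals subst hqp
    · exact (key _ _ _ ho hm').elim
    · exact (key _ _ _ ho' hm).elim
    · exact ha.voted_unique e h h' hm hm'
  · exact fun C t' _ _ ih _ => ih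

/-- Voters forward the leader's vote, so two conflicting honest votes supply everyone with an
equivocation certificate within `ΔS` of the later one. -/
theorem Reachable.voted_leader (hC : S.Reachable C) {q : Fin n} {e : ℕ} {h : H} {t : ℝ}
    (hv : Voted C q e h t) : (q, .signed (S.leader e) (.vote e h), t) ∈ C.sent := by
  refine hC.rec_spec (Q := fun C => ∀ q e h t, Voted C q e h t →
    (q, .signed (S.leader e) (.vote e h), t) ∈ C.sent) (by simp [initial, Voted]) ?_ ?_ q e h t hv
  · intro C p s' out hC _ ih hp ha q e h t hv
    rw [mem_update_sent]
    rcases voted_update.mp hv with hv | ⟨rfl, hm, rfl⟩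
    · exact .inl (ih q e h t hv)
    · exact .inr ⟨rfl, (ha.voted e h hm).2.2.2.1, rfl⟩
  · exact fun C t' _ _ ih _ => ih

/-! ### Synchronization of epochs -/

/-- Evidence that some honest replica has started epoch `e` by time `t`. -/
def Entered (S : System n P H) (C : Config n P H) : ℕ → ℝ → Prop
  | 0, t => ∃ r, S.Honest r ∧ S.start r ≤ t
  | e + 1, t => (∃ r c t', QuitBlock C r c t' ∧ c.epoch = e ∧ t' ≤ t) ∨
      ∃ r t', QuitMis S C r e t' ∧ t' + 2 * S.ΔS ≤ t

theorem Entered.mono {e : ℕ} {t t' : ℝ} (h : Entered S C e t) (ht : t ≤ t') :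
    Entered S C e t' := by
  cases e with
  | zero =>
    obtain ⟨r, hr, hs⟩ := h
    exact ⟨r, hr, hs.trans ht⟩
  | succ e =>
    rcases h with ⟨r, c, u, hq, he, hu⟩ | ⟨r, u, hq, hu⟩
    · exact .inl ⟨r, c, u, hq, he, hu.trans ht⟩
    · exact .inr ⟨r, u, hq, hu.trans ht⟩

theorem entered_tick {e : ℕ} {t t' : ℝ} : Entered S { C with now := t' } e t ↔ Entered S C e t := by
  cases e <;> rfl

theorem Entered.after_act {e : ℕ} {t : ℝ} (h : Entered S C e t) (p : Fin n) (s' : Local n P H)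
    (out : List (Msg n P H)) : Entered S (update C p s' out) e t := by
  cases e with
  | zero => exact h
  | succ e =>
    rcases h with ⟨r, c, u, hq, he, hu⟩ | ⟨r, u, hq, hu⟩
    · exact .inl ⟨r, c, u, quitBlock_update.mpr (.inl hq), he, hu⟩
    · exact .inr ⟨r, u, quitMis_update.mpr (.inl hq), hu⟩

theorem Entered.before_act (hΔS : 0 < S.ΔS) {e : ℕ} {t : ℝ} {p : Fin n} {s' : Local n P H}
    {out : List (Msg n P H)} (h : Entered S (update C p s' out) e t) :
    Entered S C e t ∨ C.now ≤ t := by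
  cases e with
  | zero => exact .inl h
  | succ e =>
    rcases h with ⟨r, c, u, hq, he, hu⟩ | ⟨r, u, hq, hu⟩
    · rcases quitBlock_update.mp hq with hq | ⟨-, -, rfl⟩
      · exact .inl (.inl ⟨r, c, u, hq, he, hu⟩)
      · exact .inr hu
    · rcases quitMis_update.mp hq with hq | ⟨-, rfl, -⟩
      · exact .inl (.inr ⟨r, u, hq, hu⟩)
      · exact .inr (by linarith)

theorem Reachable.entered (hC : S.Reachable C) {q : Fin n} (hq : S.Honest q)
    (hb : (C.loc q).booted) : Entered S C (C.loc q).epoch C.now := by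
  refine hC.rec_spec (Q := fun C => ∀ q, S.Honest q → (C.loc q).booted →
    Entered S C (C.loc q).epoch C.now) (by simp [initial, Local.initial]) ?_ ?_ q hq hb
  · intro C p s' out hC _ ih hp ha q hq hb
    rw [update_loc] at hb ⊢
    split_ifs at hb ⊢ with hqp
    · subst hqp
      cases ha.epoch with
      | same he hb' hl => exact he ▸ (ih q hq (hb'.mp hb)).after_act q s' out
      | boot he _ _ ht hl => exact he ▸ ⟨q, hq, ht.ge⟩
      | cert he _ _ c hc hce hl =>
        exact he ▸ .inl ⟨q, c, C.now, quitBlock_update.mpr (.inr ⟨rfl, hc, rfl⟩), hce, le_rfl⟩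
      | timer he _ _ hτ hset hl =>
        exact he ▸ .inr ⟨q, _, quitMis_update.mpr (.inl (hC.commit_none hτ)),
          (sub_add_cancel _ _).le⟩
    · exact (ih q hq hb).after_act p s' out
  · exact fun C t' _ _ ih ht q hq hb => entered_tick.mpr ((ih q hq hb).mono ht.lt.le)

theorem Reachable.entered_of_voted (hC : S.Reachable C) {q : Fin n} {e : ℕ} {h : H} {t : ℝ}
    (hv : Voted C q e h t) : Entered S C e t := by
  refine hC.rec_spec (Q := fun C => ∀ q e h t, Voted C q e h t → Entered S C e t)
    (by simp [initial, Voted]) ?_ ?_ q e h t hv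
  · intro C p s' out _ hC' ih hp ha q e h t hv
    rcases voted_update.mp hv with hv | ⟨rfl, hm, rfl⟩
    · exact (ih q e h t hv).after_act p s' out
    · obtain ⟨rfl, -, h3, -⟩ := ha.voted e h hm
      have := hC'.entered hp
      rw [update_loc, if_pos rfl] at this
      exact this h3
  · exact fun C t' _ _ ih _ q e h t hv => entered_tick.mpr (ih q e h t hv)

theorem Reachable.entered_of_quitMis (hC : S.Reachable C) {q : Fin n} {e : ℕ} {t : ℝ}
    (hm : QuitMis S C q e t) : Entered S C e t := by
  refine hC.rec_spec (Q := fun C => ∀ q e t, QuitMis S C q e t → Entered S C e t)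
    (by simp [initial, QuitMis]) ?_ ?_ q e t hm
  · intro C p s' out hC _ ih hp ha q e t hv
    rcases quitMis_update.mp hv with hv | ⟨rfl, rfl, c, hval, rfl, hc⟩
    · exact (ih q e t hv).after_act p s' out
    · obtain ⟨hb, he⟩ := ha.quitMis c hc hval
      exact he ▸ (hC.entered hp hb).after_act q s' out
  · exact fun C t' _ _ ih _ q e t hv => entered_tick.mpr (ih q e t hv)

theorem Reachable.entered_of_quitBlock (hC : S.Reachable C) (hfaulty : S.faulty.card ≤ S.f)
    {q : Fin n} {c : BlockCert n H} {t : ℝ} (hq : QuitBlock C q c t) :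
    Entered S C c.epoch t := by
  obtain ⟨-, r, -, u, hu, hv⟩ := hC.quitBlock hfaulty hq
  exact (hC.entered_of_voted hv).mono hu

/-- All honest replicas have left the epochs before `e`. -/
def AllReached (S : System n P H) (C : Config n P H) (e : ℕ) : Prop :=
  ∀ q, S.Honest q → (C.loc q).booted ∧ e ≤ (C.loc q).epoch

/-- After a silence or equivocation certificate of epoch `e` was broadcast at time `t`, replica `q`
has given up `e` and leaves it by `t + 3ΔS`. -/
def GivesUp (S : System n P H) (C : Config n P H) (q : Fin n) (e : ℕ) (t : ℝ) : Prop :=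
  (C.loc q).status e ≠ some .active ∧
    (e < (C.loc q).epoch ∨ ∃ d ≤ t + 3 * S.ΔS, (.commit e none, d) ∈ (C.loc q).timers)

theorem Settled.not_allVotes [Nonempty P] (hn : 2 * S.f < n) {q : Fin n} (h : Settled S C q)
    {i : H} : ¬ AllVotes (C.loc q).log (C.loc q).epoch i := fun ha =>
  h.epoch_ne (c := ⟨(C.loc q).epoch, i, Finset.univ⟩)
    ⟨by simp only [ValidBlockCert, Finset.card_univ, Fintype.card_fin]; omega, .inr fun r _ => ha r⟩
    rfl

/-- When time passes `t + ΔS`, the certificate has been processed, so `e` is not active. A replica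
still in `e` cannot have committed it, as all votes would have been a block certificate and made it
leave. Hence `e` is not-committed and its exit timer is running. -/
theorem Tick.givesUp [Nonempty P] (hn : 2 * S.f < n) (hC : S.Reachable C) {t' : ℝ}
    (ht : Tick S C t') {r : Fin n} {e : ℕ} {t : ℝ} (hm : QuitMis S C r e t)
    (hlt : t + S.ΔS < t') (hnow : C.now ≤ t + S.ΔS) (he : AllReached S C e) {q : Fin n}
    (hq : S.Honest q) : GivesUp S C q e t := by
  obtain ⟨hb, hle⟩ := he q hq
  have hset := ht.settled q hq hb
  have hi := hC.localInv q
  have hna : (C.loc q).status e ≠ some .active := by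
    obtain ⟨c, hv, rfl, hs⟩ := hm
    have hlog := (ht.deliver q hq _ _ _ hs).resolve_right (by simp [deadline, hlt])
    exact hset.not_active ⟨hv, .inl hlog⟩
  refine ⟨hna, hle.lt_or_eq.imp_right ?_⟩
  rintro rfl
  have h3 := hi.status_epoch hb
  have h4 := hi.committed
  have h5 := hi.notCommitted
  rcases hst : (C.loc q).status (C.loc q).epoch with _ | _ | _ | _
  · exact (h3 hst).elim
  · exact (hna hst).elim
  · obtain ⟨i, hall⟩ := h4 hst
    exact (hset.not_allVotes hn hall).elim
  · obtain ⟨d, hd⟩ := h5 hst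
    obtain ⟨c, -, -, hs⟩ := hC.commit_none hd
    have := (hC.sent hs).2
    -- The timer was started at `d - 2ΔS`, which is at most the current time and so at most `t +
    -- ΔS`.
    exact ⟨d, by linarith, hd⟩

/-- Honest replicas follow each other into every epoch, and give up epochs, with a delay of at
most `ΔS`. -/
theorem Reachable.synchronized [Nonempty P] (hC : S.Reachable C) (hn : 2 * S.f < n)
    (hfaulty : S.faulty.card ≤ S.f) (hΔS : 0 < S.ΔS) (hstart : ∀ p, S.Honest p → 0 ≤ S.start p)
    (hsync : ∀ p q, S.Honest p → S.Honest q → S.start p ≤ S.start q + S.ΔS) :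
    (∀ e t, Entered S C e t → t + S.ΔS < C.now → AllReached S C e) ∧
      ∀ r e t, QuitMis S C r e t → t + S.ΔS < C.now → ∀ q, S.Honest q → GivesUp S C q e t := by
  refine hC.rec_spec (Q := fun C =>
    (∀ e t, Entered S C e t → t + S.ΔS < C.now → AllReached S C e) ∧
      ∀ r e t, QuitMis S C r e t → t + S.ΔS < C.now → ∀ q, S.Honest q → GivesUp S C q e t)
    ⟨?_, by simp [initial, QuitMis]⟩ ?_ ?_
  · intro e t he hlt
    have hnow : (initial n P H).now = 0 := rfl
    cases e with
    | zero =>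
      obtain ⟨r, hr, hs⟩ := he
      linarith [hstart r hr]
    | succ e => simp [Entered, QuitBlock, QuitMis, initial] at he
  · intro C p s' out hC _ ⟨ih1, ih2⟩ hp ha
    have hle := ha.epoch.le (hC.localInv p)
    constructor
    · intro e t he hlt q hq
      rcases he.before_act hΔS with he | he
      · obtain ⟨h1, h2⟩ := ih1 e t he hlt q hq
        rw [update_loc]
        split_ifs with hqp
        · subst hqp
          exact ⟨hle.2 h1, h2.trans hle.1⟩
        · exact ⟨h1, h2⟩
      · rw [update_now] at hlt
        linarith
    · intro r e t hm hlt q hq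
      rw [update_now] at hlt
      rcases quitMis_update.mp hm with hm | ⟨-, rfl, -⟩
      · obtain ⟨h1, h2⟩ := ih2 r e t hm hlt q hq
        -- As the replica has already reached `e`, this step cannot start `e` and make it active
        -- again.
        obtain ⟨h3, h4⟩ := ih1 e t (hC.entered_of_quitMis hm) hlt q hq
        rw [GivesUp, update_loc]
        split_ifs with hqp
        · subst hqp
          refine ⟨fun hact => ?_, ?_⟩
          · have := ha.status e hact
            grind
          · rcases h2 with h2 | ⟨d, hd, hτ⟩
            · exact .inl (h2.trans_le hle.1)
            · have := ha.commit_keep e d hτ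
              grind
        · exact ⟨h1, h2⟩
      · linarith
  · intro C t' hC _ ⟨ih1, ih2⟩ ht
    -- The two claims depend on each other: giving up `e` requires having reached `e`, and reaching
    -- `e + 1` requires giving up `e`. They are therefore proved by one induction on the epoch.
    have key : ∀ e, (∀ t, Entered S C e t → t + S.ΔS < t' → AllReached S C e) →
        ∀ r t, QuitMis S C r e t → t + S.ΔS < t' → ∀ q, S.Honest q → GivesUp S C q e t := by
      intro e he r t hm hlt q hq
      rcases lt_or_ge (t + S.ΔS) C.now with hlt' | hge
      · exact ih2 r e t hm hlt' q hq
      · exact ht.givesUp hn hC hm hlt hge (he t (hC.entered_of_quitMis hm) hlt) hq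
    have key' : ∀ e t, Entered S C e t → t + S.ΔS < t' → AllReached S C e := by
      intro e
      induction e with
      | zero =>
        rintro t ⟨r, hr, hs⟩ hlt q hq
        refine ⟨?_, Nat.zero_le _⟩
        by_contra hb
        have h1 := ht.start q hq hb
        have h2 := hsync q r hq hr
        linarith
      | succ e ih =>
        intro t he hlt q hq
        rcases he with ⟨r, c, u, hc, rfl, hu⟩ | ⟨r, u, hm, hu⟩
        · obtain ⟨hb, hle⟩ := ih u (hC.entered_of_quitBlock hfaulty hc) (by linarith) q hq
          refine ⟨hb, hle.lt_of_ne ?_⟩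
          have hlog := (ht.deliver q hq _ _ _ hc).resolve_right (by simp [deadline]; linarith)
          exact (ht.settled q hq hb).epoch_ne ⟨(hC.quitBlock hfaulty hc).1, .inl hlog⟩
        · obtain ⟨hb, hle⟩ := ih u (hC.entered_of_quitMis hm) (by linarith) q hq
          refine ⟨hb, ?_⟩
          rcases (key e ih r u hm (by linarith) q hq).2 with h | ⟨d, hd, hτ⟩
          · exact h
          · have := ht.timer q hq _ _ hτ
            linarith
    exact ⟨fun e t he => key' e t (entered_tick.mp he), fun r e => key e (key' e) r⟩

/-! ### Skipped epochs and locks -/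

/-- By time `T`, an honest replica broadcast a block certificate of epoch `e`, or all honest
replicas voted for the same hash in epoch `e`. -/
def Certified (S : System n P H) (C : Config n P H) (e : ℕ) (T : ℝ) : Prop :=
  (∃ r c, ∃ t ≤ T, QuitBlock C r c t ∧ c.epoch = e) ∨
    ∃ h, ∀ r, S.Honest r → ∃ t ≤ T, Voted C r e h t

/-- Some honest replica may have left epoch `e` without a block certificate of this epoch. -/
def Skipped (S : System n P H) (C : Config n P H) (e : ℕ) : Prop :=
  ∃ q t, QuitMis S C q e t ∧ t + 2 * S.ΔS ≤ C.now ∧ ¬ Certified S C e (t + S.ΔS)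

theorem Certified.before_act {e : ℕ} {T : ℝ} {p : Fin n} {s' : Local n P H}
    {out : List (Msg n P H)} (h : Certified S (update C p s' out) e T) (hT : T < C.now) :
    Certified S C e T := by
  rcases h with ⟨r, c, t, ht, hq, he⟩ | ⟨i, hv⟩
  · rcases quitBlock_update.mp hq with hq | ⟨-, -, rfl⟩
    · exact .inl ⟨r, c, t, ht, hq, he⟩
    · linarith
  · refine .inr ⟨i, fun r hr => ?_⟩
    obtain ⟨t, ht, hvt⟩ := hv r hr
    rcases voted_update.mp hvt with hvt | ⟨-, -, rfl⟩
    · exact ⟨t, ht, hvt⟩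
    · linarith

/-- The window in which `Certified` could have occurred closes at `t + ΔS`, strictly before the
present, so later broadcasts cannot undo the skip. -/
theorem Skipped.after_act (hΔS : 0 < S.ΔS) {e : ℕ} (h : Skipped S C e) (p : Fin n)
    (s' : Local n P H) (out : List (Msg n P H)) : Skipped S (update C p s' out) e := by
  obtain ⟨q, t, hm, ht, hc⟩ := h
  exact ⟨q, t, quitMis_update.mpr (.inl hm), ht, fun hc' => hc (hc'.before_act (by linarith))⟩

theorem Skipped.after_tick {e : ℕ} (h : Skipped S C e) {t' : ℝ} (ht : C.now ≤ t') :
    Skipped S { C with now := t' } e := by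
  obtain ⟨q, t, hm, hle, hc⟩ := h
  exact ⟨q, t, hm, hle.trans ht, hc⟩

theorem Settled.not_certified [Nonempty P] (hC : S.Reachable C) (hn : 2 * S.f < n)
    (hfaulty : S.faulty.card ≤ S.f) {q : Fin n} (h : Settled S C q) :
    ¬ Certified S C (C.loc q).epoch (C.now - S.ΔS) := by
  rintro (⟨r, c, t, ht, hq, he⟩ | ⟨i, hv⟩)
  · exact h.epoch_ne_of_quitBlock (hC.quitBlock hfaulty hq).1 hq (by linarith) he
  · refine h.epoch_ne_of_voted hn hfaulty (i := i) (fun r hr => ?_) rfl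
    obtain ⟨t, ht, hvt⟩ := hv r hr
    exact ⟨t, hvt, by linarith⟩

/-- A replica that has left epoch `e` holds a lock of epoch at least `e`, unless `e` was skipped. -/
theorem Reachable.locked [Nonempty P] (hC : S.Reachable C) (hn : 2 * S.f < n)
    (hfaulty : S.faulty.card ≤ S.f) (hΔS : 0 < S.ΔS) {q : Fin n} {e : ℕ}
    (he : e < (C.loc q).epoch) :
    Skipped S C e ∨ ∃ l, (C.loc q).locked = some l ∧ e ≤ l.epoch := by
  refine hC.rec_spec (Q := fun C => ∀ q e, e < (C.loc q).epoch →
    Skipped S C e ∨ ∃ l, (C.loc q).locked = some l ∧ e ≤ l.epoch)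
    (by simp [initial, Local.initial]) ?_ ?_ q e he
  · intro C p s' out hC _ ih _ ha q e he
    suffices h : Skipped S C e ∨ ∃ l, ((update C p s' out).loc q).locked = some l ∧ e ≤ l.epoch from
      h.imp_left fun h => h.after_act hΔS p s' out
    rw [update_loc] at he ⊢
    split_ifs at he ⊢ with hqp
    · subst hqp
      cases ha.epoch with
      | same he' hb hl =>
        have := ih q e (he' ▸ he)
        grind
      | boot he' hb hb' ht hl => omega
      -- The lock may decrease here if a leader held a more recent one, but its epoch is still at
      -- least that of every epoch left.
      | cert he' hb hb' c hc hce hl => exact .inr ⟨c, hl, by omega⟩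
      | timer he' hb hb' hτ hset hl =>
        rw [hl]
        rcases (show e ≤ (C.loc q).epoch by omega).lt_or_eq with hlt | rfl
        · exact ih q e hlt
        -- The certificate was broadcast `2ΔS` ago. Anything `Certified` by `ΔS` ago would have
        -- arrived, and the settled replica would have left the epoch with a block certificate.
        · refine .inl ⟨q, _, hC.commit_none hτ, (sub_add_cancel _ _).le, ?_⟩
          rw [show C.now - 2 * S.ΔS + S.ΔS = C.now - S.ΔS by ring]
          exact hset.not_certified hC hn hfaulty
    · exact ih q e he
  · exact fun C t' _ _ ih ht q e he => (ih q e he).imp_left fun h => h.after_tick ht.lt.le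

/-! ### Decisions -/

/-- The circumstances in which a replica decides `h` in epoch `e`. -/
def Decided (S : System n P H) (C : Config n P H) (e : ℕ) (h : H) : Prop :=
  (∃ p c t, QuitBlock C p c t ∧ c.epoch = e ∧ c.id = h ∧ t + 2 * S.ΔS ≤ C.now ∧
    (∀ q h' t', Voted C q e h' t' → t' ≤ t + S.ΔS → h' = h) ∧
    ∀ q t', QuitMis S C q e t' → t + S.ΔS < t') ∨
  ∃ t ≤ C.now, (∀ r, S.Honest r → ∃ t' ≤ t, Voted C r e h t') ∧
    ∀ q t', QuitMis S C q e t' → t ≤ t' + S.ΔS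

theorem Decided.after_act (hΔS : 0 < S.ΔS) {e : ℕ} {h : H} (hd : Decided S C e h) (p : Fin n)
    (s' : Local n P H) (out : List (Msg n P H)) : Decided S (update C p s' out) e h := by
  rcases hd with ⟨r, c, t, hq, he, hi, ht, hv, hm⟩ | ⟨t, ht, hv, hm⟩
  · refine .inl ⟨r, c, t, quitBlock_update.mpr (.inl hq), he, hi, ht, fun q h' t' hv' ht' => ?_,
      fun q t' hm' => ?_⟩
    · rcases voted_update.mp hv' with hv' | ⟨-, -, rfl⟩
      · exact hv q h' t' hv' ht'
      · linarith
    · rcases quitMis_update.mp hm' with hm' | ⟨-, rfl, -⟩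
      · exact hm q t' hm'
      · linarith
  · refine .inr ⟨t, ht, fun r hr => ?_, fun q t' hm' => ?_⟩
    · obtain ⟨t', ht', hv'⟩ := hv r hr
      exact ⟨t', ht', voted_update.mpr (.inl hv')⟩
    · rcases quitMis_update.mp hm' with hm' | ⟨-, rfl, -⟩
      · exact hm q t' hm'
      · linarith

theorem Decided.after_tick {e : ℕ} {h : H} (hd : Decided S C e h) {t' : ℝ} (ht' : C.now ≤ t') :
    Decided S { C with now := t' } e h := by
  rcases hd with ⟨r, c, t, hq, he, hi, ht, hv, hm⟩ | ⟨t, ht, hv, hm⟩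
  · exact .inl ⟨r, c, t, hq, he, hi, ht.trans ht', hv, hm⟩
  · exact .inr ⟨t, ht.trans ht', hv, hm⟩

/-- The deciding replica still has `e` active. In the fast case, synchronization would have made it
give up `e` after any misbehavior certificate more than `ΔS` old. In the regular case, it is settled
at the expiry and so has seen everything small that was sent in the first `ΔS` of its waiting time.
-/
theorem Reachable.decided [Nonempty P] (hC : S.Reachable C) (hn : 2 * S.f < n)
    (hfaulty : S.faulty.card ≤ S.f) (hΔS : 0 < S.ΔS) (hstart : ∀ p, S.Honest p → 0 ≤ S.start p)
    (hsync : ∀ p q, S.Honest p → S.Honest q → S.start p ≤ S.start q + S.ΔS)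
    {p : Fin n} {e : ℕ} {h : H} (hd : (C.loc p).decision e = some h) : Decided S C e h := by
  refine hC.rec_spec (Q := fun C => ∀ q e h, (C.loc q).decision e = some h → Decided S C e h)
    (by simp [initial, Local.initial]) ?_ ?_ p e h hd
  · intro C p s' out hC _ ih hp ha q e h hd
    refine Decided.after_act hΔS ?_ p s' out
    rw [update_loc] at hd
    split_ifs at hd with hqp
    · rcases ha.decision e h hd with hd | ⟨hact, hall | ⟨hτ, hset⟩⟩
      · exact ih p e h hd
      · refine .inr ⟨C.now, le_rfl, fun r hr => hC.voted_of_mem_log hr (hall r), fun q t' hm => ?_⟩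
        by_contra! hlt
        exact ((hC.synchronized hn hfaulty hΔS hstart hsync).2 q e t' hm hlt p hp).1 hact
      · obtain ⟨c, rfl, rfl, hq⟩ := hC.commit_some hτ
        refine .inl ⟨p, c, _, hq, rfl, rfl, (sub_add_cancel _ _).le, fun q h' t' hv ht' => ?_,
          fun q t' hm => ?_⟩
        · by_contra hne
          obtain ⟨-, r, -, u, hu, hvu⟩ := hC.quitBlock hfaulty hq
          exact hset.not_active_of_votes hne (hC.voted_leader hv) (by linarith)
            (hC.voted_leader hvu) (by linarith) hact
        · by_contra! hle
          exact hset.not_active_of_quitMis hm (by linarith) hact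
    · exact ih q e h hd
  · exact fun C t' _ _ ih ht q e h hd => (ih q e h hd).after_tick ht.lt.le

/-- Honest replicas stop voting in an epoch at most `ΔS` after one of them broadcast a block
certificate of this epoch. -/
theorem Reachable.voted_le_quitBlock [Nonempty P] (hC : S.Reachable C) (hn : 2 * S.f < n)
    (hfaulty : S.faulty.card ≤ S.f) (hΔS : 0 < S.ΔS) (hstart : ∀ p, S.Honest p → 0 ≤ S.start p)
    (hsync : ∀ p q, S.Honest p → S.Honest q → S.start p ≤ S.start q + S.ΔS)
    {p q : Fin n} {c : BlockCert n H} {h : H} {t t' : ℝ} (hc : QuitBlock C p c t)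
    (hv : Voted C q c.epoch h t') : t' ≤ t + S.ΔS := by
  refine hC.rec_spec (Q := fun C => ∀ p q c h t t', QuitBlock C p c t → Voted C q c.epoch h t' →
    t' ≤ t + S.ΔS) (by simp [initial, QuitBlock]) ?_ ?_ p q c h t t' hc hv
  · intro C p s' out hC _ ih hp ha r q c h t t' hc hv
    rcases quitBlock_update.mp hc with hco | ⟨-, -, rfl⟩
    · rcases voted_update.mp hv with hvo | ⟨rfl, hm, rfl⟩
      · exact ih r q c h t t' hco hvo
      · by_contra! hlt
        have hent : Entered S C (c.epoch + 1) t := .inl ⟨r, c, t, hco, rfl, le_rfl⟩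
        have h1 := ((hC.synchronized hn hfaulty hΔS hstart hsync).1 _ t hent hlt q hp).2
        have h2 := (ha.epoch.le (hC.localInv q)).1
        have h3 := (ha.voted c.epoch h hm).1
        omega
    · rcases voted_update.mp hv with hvo | ⟨-, -, rfl⟩
      · linarith [(hC.sent hvo).2]
      · linarith
  · exact fun C t' _ _ ih _ => ih

/-- In both cases the decision puts the certifying event at most `ΔS` after any misbehavior
certificate of `e`, which is what `Certified` asks for. -/
theorem Decided.not_skipped {e : ℕ} {h : H} (hΔS : 0 < S.ΔS) (hd : Decided S C e h) :
    ¬ Skipped S C e := by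
  rintro ⟨q, u, hmu, -, hcert⟩
  rcases hd with ⟨r, c, t, hq, he, -, -, -, hm⟩ | ⟨t, -, hv, hm⟩
  · exact hcert (.inl ⟨r, c, t, by linarith [hm q u hmu], hq, he⟩)
  · refine hcert (.inr ⟨h, fun r hr => ?_⟩)
    obtain ⟨t', ht', hvt⟩ := hv r hr
    exact ⟨t', ht'.trans (hm q u hmu), hvt⟩

theorem Decided.exists_voted (hC : S.Reachable C) (hn : 2 * S.f < n)
    (hfaulty : S.faulty.card ≤ S.f) {e : ℕ} {h : H} (hd : Decided S C e h) :
    ∃ r t, Voted C r e h t := by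
  rcases hd with ⟨r, c, t, hq, rfl, rfl, -⟩ | ⟨t, -, hv, -⟩
  · obtain ⟨-, r, -, u, -, hv⟩ := hC.quitBlock hfaulty hq
    exact ⟨r, u, hv⟩
  · obtain ⟨r, hr⟩ : ∃ r, r ∉ S.faulty := by
      by_contra! hall
      have : S.faulty = Finset.univ := Finset.eq_univ_iff_forall.mpr hall
      rw [this, Finset.card_univ, Fintype.card_fin] at hfaulty
      omega
    obtain ⟨t', -, hvt⟩ := hv r hr
    exact ⟨r, t', hvt⟩

theorem Decided.eq_of_voted [Nonempty P] (hC : S.Reachable C) (hn : 2 * S.f < n)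
    (hfaulty : S.faulty.card ≤ S.f) (hΔS : 0 < S.ΔS) (hstart : ∀ p, S.Honest p → 0 ≤ S.start p)
    (hsync : ∀ p q, S.Honest p → S.Honest q → S.start p ≤ S.start q + S.ΔS)
    {e : ℕ} {h h' : H} (hd : Decided S C e h) {q : Fin n} {t' : ℝ} (hv : Voted C q e h' t') :
    h' = h := by
  rcases hd with ⟨r, c, t, hq, rfl, -, -, huniq, -⟩ | ⟨t, -, hall, -⟩
  · exact huniq q h' t' hv (hC.voted_le_quitBlock hn hfaulty hΔS hstart hsync hq hv)
  · obtain ⟨u, -, hvu⟩ := hall q (hC.sent hv).1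
    exact hC.voted_unique hv hvu

/-! ### Later votes extend the decided block -/

/-- `h` and `h'` are the hashes of blocks of which the second extends the first. -/
def Extends (S : System n P H) (h h' : H) : Prop :=
  ∃ a b, S.hash a = h ∧ S.hash b = h' ∧ Ancestor S.hash a b

/-- A vote cast in a later epoch than `e` is for a block on top of one that was certified in epoch
`e` or later, unless `e` was skipped. -/
theorem Reachable.prev_certified [Nonempty P] (hC : S.Reachable C) (hn : 2 * S.f < n)
    (hfaulty : S.faulty.card ≤ S.f) (hΔS : 0 < S.ΔS) {p : Fin n} {s' : Local n P H}
    {out : List (Msg n P H)} (hC' : S.Reachable (update C p s' out)) (ha : ActSpec S C p s' out)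
    {e e' : ℕ} {h' : H} (hm : .signed p (.vote e' h') ∈ out) :
    ∃ b, h' = S.hash b ∧ (e < e' → ¬ Skipped S (update C p s' out) e →
      ∃ c : BlockCert n H, b.prev = some c.id ∧ e ≤ c.epoch ∧ Backed S C c.epoch c.id C.now) := by
  obtain ⟨rfl, -, -, -, hcause⟩ := ha.voted e' h' hm
  cases hcause with
  | propose hp pl hh hnew hτ =>
    refine ⟨_, hh, fun hlt hskip => ?_⟩
    -- The new block is built on the lock held after the step, since the epoch may have been started
    -- in this very step.
    have hlock := (hC'.locked hn hfaulty hΔS (q := p) (e := e)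
      (by rwa [update_loc, if_pos rfl])).resolve_left hskip
    rw [update_loc, if_pos rfl] at hlock
    obtain ⟨l, hl, hle⟩ := hlock
    exact ⟨l, by simp [newBlock, hl], hle,
      ha.backed_locked hC hfaulty (fun _ => hC.backed_locked hfaulty) hl⟩
  | vote b bc hh hb he hv hprop hlead hacc hτ =>
    refine ⟨b, hh, fun hlt hskip => ?_⟩
    obtain ⟨l, hl, hle⟩ := (hC.locked hn hfaulty hΔS (q := p) (e := e) (by omega)).resolve_left
      fun h => hskip (h.after_act hΔS p s' out)
    obtain ⟨-, hvalid, hprev, hnone | ⟨l', c, hl', rfl, hlc⟩⟩ := hacc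
    · simp [hl] at hnone
    · obtain rfl : l = l' := by simpa [hl] using hl'
      exact ⟨c, hprev, hle.trans hlc, hC.backed_of_sigs hfaulty (hvalid c rfl) hprop
        fun x hx => ⟨c, rfl, hx⟩⟩

/-- If all votes of epoch `e` are for `h` and `e` was not skipped, then all later votes are for
blocks that extend the one with hash `h`. -/
theorem Reachable.extends_of_voted [Nonempty P] (hC : S.Reachable C) (hn : 2 * S.f < n)
    (hfaulty : S.faulty.card ≤ S.f) (hΔS : 0 < S.ΔS) {e : ℕ} {h : H}
    (huniq : ∀ q h' t, Voted C q e h' t → h' = h) (hskip : ¬ Skipped S C e)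
    {q : Fin n} {e' : ℕ} {h' : H} {t : ℝ} (hv : Voted C q e' h' t) (hle : e ≤ e') :
    Extends S h h' := by
  refine hC.rec_spec (Q := fun C => (∀ q h' t, Voted C q e h' t → h' = h) → ¬ Skipped S C e →
    ∀ q e' h' t, Voted C q e' h' t → e ≤ e' → Extends S h h')
    (by simp [initial, Voted]) ?_ ?_ huniq hskip q e' h' t hv hle
  · intro C p s' out hC hC' ih hp ha huniq hskip q e' h' t hv hle
    -- Both hypotheses pass to earlier configurations, because votes and skips persist.
    have ih' := ih (fun q h' t hv => huniq q h' t (voted_update.mpr (.inl hv)))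
      fun h => hskip (h.after_act hΔS p s' out)
    rcases voted_update.mp hv with hvo | ⟨rfl, hm, rfl⟩
    · exact ih' q e' h' t hvo hle
    · obtain ⟨b, rfl, hprev⟩ := hC.prev_certified hn hfaulty hΔS (e := e) hC' ha hm
      rcases hle.lt_or_eq with hlt | rfl
      -- The parent has an honest vote from before this step. The induction is over the execution,
      -- so no upper bound on `c.epoch` is needed.
      · obtain ⟨c, hbc, hec, r, -, u, -, hvu⟩ := hprev hlt hskip
        obtain ⟨b₀, b₁, rfl, hb₁, hanc⟩ := ih' r c.epoch c.id u hvu hec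
        exact ⟨b₀, b, rfl, rfl, hanc.tail (by rw [Parent, hbc, hb₁])⟩
      · exact ⟨b, b, huniq q _ _ hv, rfl, .refl⟩
  · intro C t' _ _ ih ht huniq hskip
    exact ih huniq fun h => hskip (h.after_tick ht.lt.le)

theorem Reachable.hasCommitted (hC : S.Reachable C) {p : Fin n} {b : Block P H}
    (hb : S.HasCommitted C p b) :
    ∃ e d, (C.loc p).decision e = some (S.hash d) ∧ Ancestor S.hash b d :=
  hb.elim ((hC.localInv p).ledger b) id

end System

/-! ### Ancestors and heights of blocks -/

section Height

variable {P H : Type*} {hash : Block P H → H}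

theorem Parent.unique (hhash : Function.Injective hash) {a a' b : Block P H}
    (h : Parent hash a b) (h' : Parent hash a' b) : a = a' := by
  rw [Parent, h] at h'
  exact hhash (Option.some.inj h')

theorem Ancestor.total (hhash : Function.Injective hash) {a a' d : Block P H}
    (h : Ancestor hash a d) (h' : Ancestor hash a' d) :
    Ancestor hash a a' ∨ Ancestor hash a' a := by
  induction h with
  | refl => exact .inr h'
  | tail hab hbc ih =>
    rename_i b c
    rcases Relation.ReflTransGen.cases_tail h' with rfl | ⟨x, hx, hxc⟩
    · exact .inl (hab.tail hbc)
    · obtain rfl := hbc.unique hhash hxc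
      exact ih hx

/-- Predecessors are unique, so each link changes the height by exactly one. Heights are not yet
known to be unique, hence the case `a = b` also needs the induction. -/
theorem Ancestor.height_le (hhash : Function.Injective hash) {a b : Block P H} {j k : ℕ}
    (h : Ancestor hash a b) (ha : HasHeight hash a j) (hb : HasHeight hash b k) :
    j ≤ k ∧ (j = k → a = b) := by
  induction hb generalizing a j with
  | first b hb =>
    have hab : a = b := by
      rcases Relation.ReflTransGen.cases_tail h with rfl | ⟨x, -, hx⟩
      · rfl
      · simp [Parent, hb] at hx
    subst hab
    cases ha with
    | first => exact ⟨le_rfl, fun _ => rfl⟩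
    | next x _ _ hx => simp [Parent, hb] at hx
  | next x b k hxb hx ih =>
    rcases Relation.ReflTransGen.cases_tail h with rfl | ⟨y, hay, hyb⟩
    · refine ⟨?_, fun _ => rfl⟩
      cases ha with
      | first _ hb => simp [Parent, hb] at hxb
      | next y _ j hy hj =>
        obtain rfl := hxb.unique hhash hy
        exact Nat.succ_le_succ (ih .refl hj).1
    · obtain rfl := hxb.unique hhash hyb
      have := (ih hay ha).1
      exact ⟨by omega, by omega⟩

theorem Ancestor.eq_of_height (hhash : Function.Injective hash) {a b d : Block P H} {k : ℕ}
    (ha : Ancestor hash a d) (hb : Ancestor hash b d) (hak : HasHeight hash a k)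
    (hbk : HasHeight hash b k) : a = b := by
  rcases ha.total hhash hb with h | h
  · exact (h.height_le hhash hak hbk).2 rfl
  · exact ((h.height_le hhash hbk hak).2 rfl).symm

end Height

/-! ### Comparing two decisions -/

namespace System

variable {n : ℕ} {P H : Type*} {S : System n P H} {C : Config n P H}

theorem Decided.ancestor [Nonempty P] (hC : S.Reachable C) (hn : 2 * S.f < n)
    (hfaulty : S.faulty.card ≤ S.f) (hhash : Function.Injective S.hash) (hΔS : 0 < S.ΔS)
    (hstart : ∀ p, S.Honest p → 0 ≤ S.start p)
    (hsync : ∀ p q, S.Honest p → S.Honest q → S.start p ≤ S.start q + S.ΔS)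
    {e e' : ℕ} {d d' : Block P H} (hd : Decided S C e (S.hash d))
    (hd' : Decided S C e' (S.hash d')) (hle : e ≤ e') : Ancestor S.hash d d' := by
  obtain ⟨r, t, hv⟩ := hd'.exists_voted hC hn hfaulty
  obtain ⟨b, b', hb, hb', hanc⟩ := hC.extends_of_voted hn hfaulty hΔS
    (fun _ _ _ hv => hd.eq_of_voted hC hn hfaulty hΔS hstart hsync hv) (hd.not_skipped hΔS) hv hle
  rwa [hhash hb, hhash hb'] at hanc

end System

end AlterBFT

theorem mainTheorem1 {n : ℕ} {P H : Type*} (S : AlterBFT.System n P H)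
    (hn : 2 * S.f < n) (hfaulty : S.faulty.card ≤ S.f)
    (hhash : Function.Injective S.hash)
    (hΔS : 0 < S.ΔS) (hΔL : 0 < S.ΔL)
    (hstart : ∀ p, S.Honest p → 0 ≤ S.start p)
    (hsync : ∀ p q, S.Honest p → S.Honest q → S.start p ≤ S.start q + S.ΔS)
    (C : AlterBFT.Config n P H) (hC : S.Reachable C)
    (p q : Fin n) (hp : S.Honest p) (hq : S.Honest q)
    (b b' : AlterBFT.Block P H) (k : ℕ)
    (hb : AlterBFT.System.HasCommitted S C p b) (hb' : AlterBFT.System.HasCommitted S C q b')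
    (hk : AlterBFT.HasHeight S.hash b k) (hk' : AlterBFT.HasHeight S.hash b' k) :
    b = b' := by
  -- The committed block itself supplies the payload that makes `StartEpoch` always executable.
  have : Nonempty P := ⟨b.payload⟩
  obtain ⟨e, d, hd, hbd⟩ := AlterBFT.System.Reachable.hasCommitted hC hb
  obtain ⟨e', d', hd', hbd'⟩ := AlterBFT.System.Reachable.hasCommitted hC hb'
  have hdec := AlterBFT.System.Reachable.decided hC hn hfaulty hΔS hstart hsync hd
  have hdec' := AlterBFT.System.Reachable.decided hC hn hfaulty hΔS hstart hsync hd'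
  rcases le_total e e' with hle | hle
  · have hdd := hdec.ancestor hC hn hfaulty hhash hΔS hstart hsync hdec' hle
    exact AlterBFT.Ancestor.eq_of_height hhash (Relation.ReflTransGen.trans hbd hdd) hbd' hk hk'
  · have hdd := hdec'.ancestor hC hn hfaulty hhash hΔS hstart hsync hdec hle
    exact AlterBFT.Ancestor.eq_of_height hhash hbd (Relation.ReflTransGen.trans hbd' hdd) hk hk'
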